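/- Work in the universe $V$ of sets. Ultrafilters may be principal; a countably complete ultrafilter is an ultrafilter on a set closed under countable intersections. If $M$ is a transitive class model and $W\in M$ is, in $M$, a countably complete ultrafilter on a set $Y$, then $\mathrm{Ult}(M,W)$ denotes the transitive collapse of the ultrapower of $M$ by $W$ formed with functions on $Y$ that belong to $M$, and $j_W : M\to \mathrm{Ult}(M,W)$ the ultrapower embedding $j_W(a)=[\text{const}_a]_W$. The Ultrapower Axiom is the statement that for all countably complete ultrafilters $U_0,U_1$ there are $W_0\in\mathrm{Ult}(V,U_0)$ and $W_1\in\mathrm{Ult}(V,U_1)$ such that, for $i=0,1$, $\mathrm{Ult}(V,U_i)\vDash$ "$W_i$ is a countably complete ultrafilter", $\mathrm{Ult}(\mathrm{Ult}(V,U_0),W_0)=\mathrm{Ult}(\mathrm{Ult}(V,U_1),W_1)$, and $j_{W_0}\circ j_{U_0}=j_{W_1}\circ j_{U_1}$. For countably complete ultrafilters $U_0,U_1$, the Mitchell order is defined by $U_0<_M U_1$ if and only if $U_0\in\mathrm{Ult}(V,U_1)$. A measurable cardinal is an uncountable cardinal $\kappa$ carrying a $\kappa$-complete nonprincipal ultrafilter,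 and a normal ultrafilter on $\kappa$ is a $\kappa$-complete nonprincipal ultrafilter $U$ on $\kappa$ such that every function that is regressive on a set in $U$ is constant on a set in $U$. Theorem. Assume the Ultrapower Axiom. If $U_0$ and $U_1$ are normal ultrafilters on a measurable cardinal $\kappa$, then $U_0<_M U_1$, or $U_0=U_1$, or $U_1<_M U_0$. Moreover, the Mitchell order is a strict linear order (irreflexive, transitive and trichotomous) on the class of all normal ultrafilters on measurable cardinals. -/

import Mathlib

universe u

namespace SetUltrapower

/-- The underlying set of an ultrafilter: if `W` is an ultrafilter on `Y`, then `⋃ W = Y`. -/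
noncomputable def space (W : ZFSet.{u}) : ZFSet.{u} := ZFSet.sUnion W

/-- `W` is an ultrafilter (on the set `space W`) in the sense of the transitive class `M`.
Only sets belonging to `M` are tested. For `M = Set.univ` this is the usual notion. -/
structure IsUltrafilterIn (M : Set ZFSet.{u}) (W : ZFSet.{u}) : Prop where
  mem_model : W ∈ M
  space_mem : space W ∈ W
  empty_notMem : ∅ ∉ W
  mono : ∀ A ∈ W, ∀ B ∈ M, A ⊆ B → B ⊆ space W → B ∈ W
  inter : ∀ A ∈ W, ∀ B ∈ W, A ∩ B ∈ W
  ultra : ∀ A ∈ M, A ⊆ space W → A ∈ W ∨ space W \ A ∈ W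

/-- `W` is a countably complete ultrafilter in the sense of the transitive class `M`: it is closed
under intersections of those `ω`-sequences of its members that belong to `M`. Principal
ultrafilters are allowed. -/
structure IsCountablyCompleteIn (M : Set ZFSet.{u}) (W : ZFSet.{u}) : Prop
    extends IsUltrafilterIn M W where
  countable_inter : ∀ s ∈ M, ZFSet.IsFunc ZFSet.omega W s →
    (space W).sep (fun y => ∀ n A, ZFSet.pair n A ∈ s → y ∈ A) ∈ W

/-- The functions (sets of ordered pairs) in `M` with domain `space W`. -/
def UltFun (M : Set ZFSet.{u}) (W : ZFSet.{u}) : Set ZFSet.{u} :=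
  {f | f ∈ M ∧ ∃ Z, ZFSet.IsFunc (space W) Z f}

/-- The set `{y ∈ Y | f y = g y}` for functions `f`, `g` with domain `Y`. -/
def eqSet (Y f g : ZFSet.{u}) : ZFSet.{u} :=
  Y.sep (fun y => ∃ a b, ZFSet.pair y a ∈ f ∧ ZFSet.pair y b ∈ g ∧ a = b)

/-- The set `{y ∈ Y | f y ∈ g y}` for functions `f`, `g` with domain `Y`. -/
def memSet (Y f g : ZFSet.{u}) : ZFSet.{u} :=
  Y.sep (fun y => ∃ a b, ZFSet.pair y a ∈ f ∧ ZFSet.pair y b ∈ g ∧ a ∈ b)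

/-- `N = Ult(M, W)`, with `π f = [f]_W`: the class `N` is the transitive collapse of the ultrapower
of `M` by `W` formed with functions in `M`, and `π` sends such a function to the element of the
collapse which it represents. (The values of `π` at other sets are irrelevant.) -/
structure IsUltrapower (M : Set ZFSet.{u}) (W : ZFSet.{u}) (N : Set ZFSet.{u})
    (π : ZFSet.{u} → ZFSet.{u}) : Prop where
  transitive : ∀ x ∈ N, ∀ y ∈ x, y ∈ N
  image_eq : π '' UltFun M W = N
  eq_iff : ∀ f ∈ UltFun M W, ∀ g ∈ UltFun M W, π f = π g ↔ eqSet (space W) f g ∈ W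
  mem_iff : ∀ f ∈ UltFun M W, ∀ g ∈ UltFun M W, π f ∈ π g ↔ memSet (space W) f g ∈ W

/-- The constant function on `space W` with value `a`. -/
noncomputable def const (W a : ZFSet.{u}) : ZFSet.{u} := (space W).prod {a}

/-- The ultrapower embedding `j_W(a) = [const a]_W`, where `π f = [f]_W`. -/
noncomputable def embedding (W : ZFSet.{u}) (π : ZFSet.{u} → ZFSet.{u}) (a : ZFSet.{u}) :
    ZFSet.{u} := π (const W a)

/-- `⟨W₀, W₁⟩` is a comparison of `⟨U₀, U₁⟩` by internal ultrafilters: here `M₀ = Ult(V, U₀)`,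
`M₁ = Ult(V, U₁)`, and `P = Ult(M₀, W₀) = Ult(M₁, W₁)`. -/
def IsComparison (U₀ U₁ W₀ W₁ : ZFSet.{u}) : Prop :=
  ∃ (M₀ M₁ P : Set ZFSet.{u}) (π₀ π₁ ρ₀ ρ₁ : ZFSet.{u} → ZFSet.{u}),
    IsUltrapower Set.univ U₀ M₀ π₀ ∧ IsUltrapower Set.univ U₁ M₁ π₁ ∧
    IsCountablyCompleteIn M₀ W₀ ∧ IsCountablyCompleteIn M₁ W₁ ∧
    IsUltrapower M₀ W₀ P ρ₀ ∧ IsUltrapower M₁ W₁ P ρ₁ ∧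
    ∀ a : ZFSet.{u},
      embedding W₀ ρ₀ (embedding U₀ π₀ a) = embedding W₁ ρ₁ (embedding U₁ π₁ a)

/-- The Ultrapower Axiom: every pair of countably complete ultrafilters admits a comparison by
internal ultrafilters. The universe of sets is `ZFSet.{u}`. -/
def UltrapowerAxiom : Prop :=
  ∀ U₀ U₁ : ZFSet.{u}, IsCountablyCompleteIn Set.univ U₀ → IsCountablyCompleteIn Set.univ U₁ →
    ∃ W₀ W₁ : ZFSet.{u}, IsComparison U₀ U₁ W₀ W₁

/-- The Mitchell order: `U₀ ∈ Ult(V, U₁)`. -/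
def MitchellLT (U₀ U₁ : ZFSet.{u}) : Prop :=
  ∃ N π, IsUltrapower Set.univ U₁ N π ∧ U₀ ∈ N

/-- `U` is a `κ`-complete nonprincipal ultrafilter on the ordinal `κ`. -/
structure IsCompleteNonprincipal (κ U : ZFSet.{u}) : Prop
    extends IsUltrafilterIn Set.univ U where
  space_eq : space U = κ
  nonprincipal : ∀ ξ ∈ κ, {ξ} ∉ U
  complete : ∀ α ∈ κ, ∀ A : ZFSet.{u} → ZFSet.{u}, (∀ β ∈ α, A β ∈ U) →
    κ.sep (fun ξ => ∀ β ∈ α, ξ ∈ A β) ∈ U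

/-- `κ` is a measurable cardinal: an uncountable (von Neumann) cardinal carrying a `κ`-complete
nonprincipal ultrafilter. -/
structure IsMeasurableCardinal (κ : ZFSet.{u}) : Prop where
  ordinal : κ.IsOrdinal
  initial : ∀ α ∈ κ, α.card < κ.card
  uncountable : Cardinal.aleph0 < κ.card
  exists_ultrafilter : ∃ U, IsCompleteNonprincipal κ U

/-- `U` is a normal ultrafilter on `κ`: a `κ`-complete nonprincipal ultrafilter such that every
function which is regressive on a set in `U` is constant on a set in `U`. -/
structure IsNormalUltrafilter (κ U : ZFSet.{u}) : Prop
    extends IsCompleteNonprincipal κ U where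
  normal : ∀ F : ZFSet.{u} → ZFSet.{u}, κ.sep (fun ξ => F ξ ∈ ξ) ∈ U →
    ∃ β ∈ κ, κ.sep (fun ξ => F ξ = β) ∈ U

/-! ### Existence and uniqueness of the transitive collapse -/

theorem IsUltrapower.map_eq {M : Set ZFSet.{u}} {W : ZFSet.{u}} {N N' : Set ZFSet.{u}}
    {π π' : ZFSet.{u} → ZFSet.{u}} (h : IsUltrapower M W N π) (h' : IsUltrapower M W N' π') :
    ∀ x : ZFSet.{u}, ∀ f ∈ UltFun M W, π f = x → π' f = x := by
  intro x
  induction x using ZFSet.inductionOn with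
  | _ x ih =>
    rintro f hf rfl
    ext y
    constructor
    · intro hy
      have hN : π' f ∈ N' := h'.image_eq ▸ Set.mem_image_of_mem _ hf
      have hyN := h'.transitive _ hN _ hy
      rw [← h'.image_eq] at hyN
      obtain ⟨g, hg, rfl⟩ := hyN
      have hgf : π g ∈ π f := (h.mem_iff g hg f hf).2 ((h'.mem_iff g hg f hf).1 hy)
      rw [ih _ hgf g hg rfl]
      exact hgf
    · intro hy
      have hN : π f ∈ N := h.image_eq ▸ Set.mem_image_of_mem _ hf
      have hyN := h.transitive _ hN _ hy
      rw [← h.image_eq] at hyN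
      obtain ⟨g, hg, rfl⟩ := hyN
      have hgf : π' g ∈ π' f := (h'.mem_iff g hg f hf).2 ((h.mem_iff g hg f hf).1 hy)
      rw [← ih _ hy g hg rfl]
      exact hgf

/-- The ultrapower is unique. -/
theorem IsUltrapower.unique {M : Set ZFSet.{u}} {W : ZFSet.{u}} {N N' : Set ZFSet.{u}}
    {π π' : ZFSet.{u} → ZFSet.{u}} (h : IsUltrapower M W N π) (h' : IsUltrapower M W N' π') :
    N = N' ∧ ∀ f ∈ UltFun M W, π f = π' f := by
  have key : ∀ f ∈ UltFun M W, π f = π' f := fun f hf => (h.map_eq h' _ f hf rfl).symm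
  refine ⟨?_, key⟩
  rw [← h.image_eq, ← h'.image_eq]
  exact Set.image_congr key

/-- The value at `y` of a function given as a set of ordered pairs. -/
noncomputable def app (f y : ZFSet.{u}) : ZFSet.{u} :=
  Classical.epsilon (fun w => ZFSet.pair y w ∈ f)

theorem pair_mem_iff {Y Z f y w : ZFSet.{u}} (hf : ZFSet.IsFunc Y Z f) (hy : y ∈ Y) :
    ZFSet.pair y w ∈ f ↔ w = app f y := by
  obtain ⟨v, hv, huniq⟩ := hf.2 y hy
  have h1 : ZFSet.pair y (app f y) ∈ f :=
    Classical.epsilon_spec (p := fun w => ZFSet.pair y w ∈ f) ⟨v, hv⟩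
  constructor
  · intro h
    rw [huniq w h, huniq _ h1]
  · rintro rfl
    exact h1

section Existence

variable {U : ZFSet.{u}}

/-- `G` and `F` agree on a set in `U`. -/
def EqMod (U : ZFSet.{u}) (G F : ZFSet.{u} → ZFSet.{u}) : Prop :=
  (space U).sep (fun y => G y = F y) ∈ U

/-- `G y ∈ F y` for all `y` in a set in `U`. -/
def MemMod (U : ZFSet.{u}) (G F : ZFSet.{u} → ZFSet.{u}) : Prop :=
  (space U).sep (fun y => G y ∈ F y) ∈ U

theorem sep_mono (hU : IsUltrafilterIn Set.univ U) {p q : ZFSet.{u} → Prop}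
    (hp : (space U).sep p ∈ U) (h : ∀ y ∈ space U, p y → q y) : (space U).sep q ∈ U := by
  refine hU.mono _ hp _ (Set.mem_univ _) ?_ ?_
  · intro y hy
    rw [ZFSet.mem_sep] at hy ⊢
    exact ⟨hy.1, h y hy.1 hy.2⟩
  · intro y hy
    exact (ZFSet.mem_sep.1 hy).1

theorem sep_and (hU : IsUltrafilterIn Set.univ U) {p q : ZFSet.{u} → Prop}
    (hp : (space U).sep p ∈ U) (hq : (space U).sep q ∈ U) :
    (space U).sep (fun y => p y ∧ q y) ∈ U := by
  have := hU.inter _ hp _ hq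
  convert! this using 1
  ext y
  simp only [ZFSet.mem_sep, ZFSet.mem_inter]
  tauto

theorem sep_not (hU : IsUltrafilterIn Set.univ U) {p : ZFSet.{u} → Prop}
    (hp : (space U).sep p ∉ U) : (space U).sep (fun y => ¬ p y) ∈ U := by
  have := (hU.ultra ((space U).sep p) (Set.mem_univ _)
    (fun y hy => (ZFSet.mem_sep.1 hy).1)).resolve_left hp
  convert! this using 1
  ext y
  rw [ZFSet.mem_sdiff, ZFSet.mem_sep, ZFSet.mem_sep]
  tauto

theorem sep_exists (hU : IsUltrafilterIn Set.univ U) {p : ZFSet.{u} → Prop}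
    (hp : (space U).sep p ∈ U) : ∃ y, p y := by
  by_contra! h
  apply hU.empty_notMem
  convert! hp using 1
  ext y
  simp [h]

theorem exists_omega_index : ∃ e : ZFSet.{u} → ℕ, ∀ n : ℕ, ∃ z ∈ ZFSet.omega, e z = n := by
  have hinj : Function.Injective (fun n : ℕ => Ordinal.toZFSet.{u} (n : Ordinal.{u})) :=
    Ordinal.toZFSet_injective.comp Nat.cast_injective
  refine ⟨Function.invFun (fun n : ℕ => Ordinal.toZFSet.{u} (n : Ordinal.{u})), fun n =>
    ⟨Ordinal.toZFSet.{u} (n : Ordinal.{u}), ?_, Function.leftInverse_invFun hinj n⟩⟩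
  induction n with
  | zero => simp [ZFSet.omega_zero]
  | succ n ih =>
    rw [Nat.cast_succ, Ordinal.toZFSet_add_one]
    exact ZFSet.omega_succ ih

open Classical in
theorem wellFounded_memMod (hU : IsCountablyCompleteIn Set.univ U) :
    WellFounded (MemMod U) := by
  rw [wellFounded_iff_isEmpty_descending_chain]
  refine ⟨fun ⟨F, hF⟩ => ?_⟩
  obtain ⟨e, he⟩ := exists_omega_index.{u}
  let S : ZFSet.{u} → ZFSet.{u} := fun z => (space U).sep (fun y => F (e z + 1) y ∈ F (e z) y)
  let _ : ZFSet.Definable₁ S := Classical.allZFSetDefinable _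
  have h1 := hU.countable_inter (ZFSet.map S ZFSet.omega) (Set.mem_univ _)
    (ZFSet.map_isFunc.2 fun z _ => hF (e z))
  obtain ⟨y, hy⟩ := sep_exists hU.toIsUltrafilterIn h1
  have hdesc : ∀ n : ℕ, F (n + 1) y ∈ F n y := by
    intro n
    obtain ⟨z, hz, rfl⟩ := he n
    have := hy z (S z) (ZFSet.mem_map.2 ⟨z, hz, rfl⟩)
    exact (ZFSet.mem_sep.1 this).2
  exact (wellFounded_iff_isEmpty_descending_chain.1 ZFSet.mem_wf).false ⟨fun n => F n y, hdesc⟩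

/-- A set containing codes for all `G` with `MemMod U G F`, up to `EqMod U`. -/
noncomputable def codes (U : ZFSet.{u}) (F : ZFSet.{u} → ZFSet.{u}) : ZFSet.{u} :=
  ZFSet.powerset ((space U).prod (ZFSet.iUnion (fun y : space U => F y)))

theorem exists_code (hU : IsUltrafilterIn Set.univ U) {G F : ZFSet.{u} → ZFSet.{u}}
    (h : MemMod U G F) : ∃ R ∈ codes U F, EqMod U (app R) G := by
  refine ⟨ZFSet.pairSep (fun y w => w = G y ∧ w ∈ F y) (space U)
    (ZFSet.iUnion (fun y : space U => F y)), ?_, ?_⟩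
  · rw [codes, ZFSet.mem_powerset]
    intro z hz
    obtain ⟨a, ha, b, hb, rfl, -⟩ := ZFSet.mem_pairSep.1 hz
    exact ZFSet.pair_mem_prod.2 ⟨ha, hb⟩
  · refine sep_mono hU h fun y hy hGF => ?_
    have key : ∀ w, ZFSet.pair y w ∈ ZFSet.pairSep (fun y w => w = G y ∧ w ∈ F y) (space U)
        (ZFSet.iUnion (fun y : space U => F y)) ↔ w = G y := by
      intro w
      rw [ZFSet.mem_pairSep]
      constructor
      · rintro ⟨a, -, b, -, hab, hb, -⟩
        obtain ⟨rfl, rfl⟩ := ZFSet.pair_inj.1 hab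
        exact hb
      · rintro rfl
        exact ⟨y, hy, G y, ZFSet.mem_iUnion.2 ⟨⟨y, hy⟩, hGF⟩, rfl, rfl, hGF⟩
    exact (key _).1 (Classical.epsilon_spec (p := fun w => ZFSet.pair y w ∈ _)
      ⟨G y, (key _).2 rfl⟩)

theorem EqMod.symm (hU : IsUltrafilterIn Set.univ U) {G F : ZFSet.{u} → ZFSet.{u}}
    (h : EqMod U G F) : EqMod U F G :=
  sep_mono hU h fun _ _ h => h.symm

theorem EqMod.trans (hU : IsUltrafilterIn Set.univ U) {G F H : ZFSet.{u} → ZFSet.{u}}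
    (h : EqMod U G F) (h' : EqMod U F H) : EqMod U G H :=
  sep_mono hU (sep_and hU h h') fun _ _ h => h.1.trans h.2

theorem MemMod.congr (hU : IsUltrafilterIn Set.univ U) {G G' F F' : ZFSet.{u} → ZFSet.{u}}
    (h : MemMod U G F) (hG : EqMod U G G') (hF : EqMod U F F') : MemMod U G' F' :=
  sep_mono hU (sep_and hU h (sep_and hU hG hF)) fun _ _ h => h.2.1 ▸ h.2.2 ▸ h.1

/-- There is a collapsing map for the ultrapower of the universe. -/
theorem exists_collapse (hU : IsCountablyCompleteIn Set.univ U) :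
    ∃ p : (ZFSet.{u} → ZFSet.{u}) → ZFSet.{u}, (∀ F G, EqMod U F G → p F = p G) ∧
      ∀ F b, b ∈ p F ↔ ∃ G, MemMod U G F ∧ p G = b := by
  have hU' := hU.toIsUltrafilterIn
  have wf := wellFounded_memMod hU
  let p : (ZFSet.{u} → ZFSet.{u}) → ZFSet.{u} := wf.fix (fun F ih =>
    ZFSet.range (fun R : {R : codes U F // MemMod U (app R) F} => ih (app R.1) R.2))
  have hp : ∀ F b, b ∈ p F ↔ ∃ R ∈ codes U F, MemMod U (app R) F ∧ p (app R) = b := by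
    intro F b
    simp only [p]
    rw [wf.fix_eq, ZFSet.mem_range]
    constructor
    · rintro ⟨⟨⟨R, hR⟩, hRF⟩, rfl⟩
      exact ⟨R, hR, hRF, rfl⟩
    · rintro ⟨R, hR, hRF, rfl⟩
      exact ⟨⟨⟨R, hR⟩, hRF⟩, rfl⟩
  have hcongr : ∀ F G, EqMod U F G → p F = p G := by
    intro F
    induction F using wf.induction with
    | _ F ih =>
      intro F' hFF'
      ext b
      rw [hp, hp]
      constructor
      · rintro ⟨R, hR, hRF, rfl⟩
        have h1 := hRF.congr hU' (sep_mono hU' hFF' fun _ _ _ => rfl) hFF'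
        obtain ⟨R', hR', he⟩ := exists_code hU' h1
        exact ⟨R', hR', h1.congr hU' (he.symm hU') (sep_mono hU' hFF' fun _ _ _ => rfl),
          (ih _ hRF _ (he.symm hU')).symm⟩
      · rintro ⟨R', hR', hRF, rfl⟩
        have h1 := hRF.congr hU' (sep_mono hU' hFF' fun _ _ _ => rfl) (hFF'.symm hU')
        obtain ⟨R, hR, he⟩ := exists_code hU' h1
        have h2 := h1.congr hU' (he.symm hU') (sep_mono hU' hFF' fun _ _ _ => rfl)
        exact ⟨R, hR, h2, ih _ h2 _ he⟩
  refine ⟨p, hcongr, fun F b => ?_⟩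
  rw [hp]
  constructor
  · rintro ⟨R, -, hRF, rfl⟩
    exact ⟨_, hRF, rfl⟩
  · rintro ⟨G, hG, rfl⟩
    obtain ⟨R, hR, he⟩ := exists_code hU' hG
    exact ⟨R, hR, hG.congr hU' (he.symm hU') (sep_mono hU' he fun _ _ _ => rfl), hcongr _ _ he⟩

theorem eqSet_mem_iff {f g : ZFSet.{u}} (hf : f ∈ UltFun Set.univ U)
    (hg : g ∈ UltFun Set.univ U) : eqSet (space U) f g ∈ U ↔ EqMod U (app f) (app g) := by
  obtain ⟨-, Z, hf⟩ := hf
  obtain ⟨-, Z', hg⟩ := hg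
  suffices h : eqSet (space U) f g = (space U).sep (fun y => app f y = app g y) by
    rw [h, EqMod]
  ext y
  rw [eqSet, ZFSet.mem_sep, ZFSet.mem_sep]
  refine and_congr_right fun hy => ?_
  simp [pair_mem_iff hf hy, pair_mem_iff hg hy]

theorem memSet_mem_iff {f g : ZFSet.{u}} (hf : f ∈ UltFun Set.univ U)
    (hg : g ∈ UltFun Set.univ U) : memSet (space U) f g ∈ U ↔ MemMod U (app f) (app g) := by
  obtain ⟨-, Z, hf⟩ := hf
  obtain ⟨-, Z', hg⟩ := hg
  suffices h : memSet (space U) f g = (space U).sep (fun y => app f y ∈ app g y) by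
    rw [h, MemMod]
  ext y
  rw [memSet, ZFSet.mem_sep, ZFSet.mem_sep]
  refine and_congr_right fun hy => ?_
  simp [pair_mem_iff hf hy, pair_mem_iff hg hy]

open Classical in
theorem exists_fun (hU : IsUltrafilterIn Set.univ U) (G : ZFSet.{u} → ZFSet.{u}) :
    ∃ f ∈ UltFun Set.univ U, EqMod U (app f) G := by
  let _ : ZFSet.Definable₁ G := Classical.allZFSetDefinable _
  have hf : ZFSet.IsFunc (space U) (ZFSet.image G (space U)) (ZFSet.map G (space U)) :=
    ZFSet.map_isFunc.2 fun z hz => ZFSet.mem_image.2 ⟨z, hz, rfl⟩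
  refine ⟨ZFSet.map G (space U), ⟨Set.mem_univ _, _, hf⟩, ?_⟩
  rw [EqMod]
  convert! hU.space_mem using 1
  ext y
  rw [ZFSet.mem_sep]
  refine and_iff_left_of_imp fun hy => ?_
  exact ((pair_mem_iff hf hy).1 (ZFSet.mem_map.2 ⟨y, hy, rfl⟩)).symm

/-- The transitive collapse of the ultrapower of the universe by a countably complete ultrafilter
exists. -/
theorem exists_isUltrapower (hU : IsCountablyCompleteIn Set.univ U) :
    ∃ N π, IsUltrapower Set.univ U N π := by
  have hU' := hU.toIsUltrafilterIn
  obtain ⟨p, hcongr, hp⟩ := exists_collapse hU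
  have wf := wellFounded_memMod hU
  have hrefl : ∀ F, EqMod U F F := fun F => by
    obtain ⟨f, -, hf⟩ := exists_fun hU' F
    exact (hf.symm hU').trans hU' hf
  have hinj : ∀ F G, p F = p G → EqMod U F G := by
    intro F
    induction F using wf.induction with
    | _ F ih =>
      intro G hFG
      by_contra hne
      have h1 := sep_not hU' hne
      by_cases h2 : (space U).sep (fun y => ∃ z, z ∈ F y ∧ z ∉ G y) ∈ U
      · let H : ZFSet.{u} → ZFSet.{u} := fun y =>
          Classical.epsilon (fun z => z ∈ F y ∧ z ∉ G y)
        have h3 : (space U).sep (fun y => H y ∈ F y ∧ H y ∉ G y) ∈ U :=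
          sep_mono hU' h2 fun y _ hy => Classical.epsilon_spec hy
        have hHF : MemMod U H F := sep_mono hU' h3 fun _ _ h => h.1
        obtain ⟨K, hKG, hK⟩ := (hp G (p H)).1 (hFG ▸ (hp F (p H)).2 ⟨H, hHF, rfl⟩)
        have h4 := hKG.congr hU' ((ih H hHF K hK.symm).symm hU') (hrefl G)
        obtain ⟨y, hy⟩ := sep_exists hU' (sep_and hU' h3 h4)
        exact hy.1.2 hy.2
      · have h2' := sep_not hU' h2
        let H : ZFSet.{u} → ZFSet.{u} := fun y =>
          Classical.epsilon (fun z => z ∈ G y ∧ z ∉ F y)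
        have h3 : (space U).sep (fun y => H y ∈ G y ∧ H y ∉ F y) ∈ U := by
          refine sep_mono hU' (sep_and hU' h1 h2') fun y _ hy =>
            Classical.epsilon_spec (p := fun z => z ∈ G y ∧ z ∉ F y) ?_
          by_contra! h
          refine hy.1 (ZFSet.ext fun z => ⟨fun hz => ?_, h z⟩)
          by_contra hz'
          exact hy.2 ⟨z, hz, hz'⟩
        have hHG : MemMod U H G := sep_mono hU' h3 fun _ _ h => h.1
        obtain ⟨K, hKF, hK⟩ := (hp F (p H)).1 (hFG ▸ (hp G (p H)).2 ⟨H, hHG, rfl⟩)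
        have h4 := hKF.congr hU' (ih K hKF H hK) (hrefl F)
        obtain ⟨y, hy⟩ := sep_exists hU' (sep_and hU' h3 h4)
        exact hy.1.2 hy.2
  refine ⟨(fun f => p (app f)) '' UltFun Set.univ U, fun f => p (app f), ?_, rfl, ?_, ?_⟩
  · rintro _ ⟨f, -, rfl⟩ y hy
    obtain ⟨G, -, rfl⟩ := (hp _ _).1 hy
    obtain ⟨g, hg, he⟩ := exists_fun hU' G
    exact ⟨g, hg, hcongr _ _ he⟩
  · intro f hf g hg
    rw [eqSet_mem_iff hf hg]
    exact ⟨hinj _ _, hcongr _ _⟩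
  · intro f hf g hg
    rw [memSet_mem_iff hf hg, hp]
    constructor
    · rintro ⟨G, hG, he⟩
      exact hG.congr hU' (hinj _ _ he) (hrefl _)
    · exact fun h => ⟨_, h, rfl⟩

end Existence

end SetUltrapower

namespace SetUltrapower

open Filter

/-! ### Germs modulo an ultrafilter -/

/-! Write `j₀ : V → M₀` and `j₁ : V → M₁` for the ultrapowers by normal `U₀`, `U₁` on `κ`. Normality
says that `κ` is represented by the identity, so `A ∈ Uᵢ` iff `κ ∈ jᵢ(A)`. It also puts every subset
of `κ` into `Mᵢ` (`Collapse.map_inter_id`). The Ultrapower Axiom gives internal ultrapowers `i₀ : M₀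
→ P`, `i₁ : M₁ → P` with `i₀ ∘ j₀ = i₁ ∘ j₁`. The points `i₀(κ)` and `i₁(κ)` both lie in the ordinal
`i₀(j₀(κ)) = i₁(j₁(κ))`, so they are comparable. If they are equal, both ultrafilters are derived
from one embedding and one point, so `U₀ = U₁`. If `i₀(κ) < i₁(κ)`, then `A ∈ U₀` iff `i₀(κ) ∈
i₁(j₁(A))` iff `i₀(κ) ∈ i₁(j₁(A) ∩ κ) = i₁(A)`. The last condition can be evaluated in `M₁` from
`W₁` and a function representing `i₀(κ)`, so `U₀ ∈ M₁` (`mem_model_of_embedding_mem`,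
`derived_mem_model`). The remaining order properties do not use the axiom. Irreflexivity is a
diagonal argument. An ultrafilter on a smaller cardinal is below one on a larger cardinal
(`mitchellLT_of_mem`) and never the reverse (`notMem_of_mitchellLT`). This reduces transitivity to a
single cardinal, where representing functions are composed (`mitchellLT_trans_of_same`). -/

theorem subset_space {U A : ZFSet.{u}} (hA : A ∈ U) : A ⊆ space U := fun _ hy =>
  ZFSet.mem_sUnion_of_mem hy hA

/-- The ultrafilter on the type of all sets induced by an ultrafilter on a set. -/
def toUltrafilter {U : ZFSet.{u}} (hU : IsUltrafilterIn Set.univ U) : Ultrafilter ZFSet.{u} :=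
  Ultrafilter.ofComplNotMemIff
    { sets := {S | (space U).sep (· ∈ S) ∈ U}
      univ_sets := by
        refine hU.mono _ hU.space_mem _ (Set.mem_univ _) ?_ ?_ <;> intro y hy <;>
          simp_all [ZFSet.mem_sep]
      sets_of_superset := fun hS hST => sep_mono hU hS fun _ _ h => hST h
      inter_sets := fun hS hT => sep_and hU hS hT }
    (by
      intro S
      constructor
      · intro h
        by_contra h'
        exact h (sep_not hU h')
      · intro h h'
        obtain ⟨y, hy⟩ := sep_exists hU (sep_and hU h h')
        exact hy.2 hy.1)

theorem eventually_toUltrafilter {U : ZFSet.{u}} (hU : IsUltrafilterIn Set.univ U)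
    {P : ZFSet.{u} → Prop} : (∀ᶠ y in toUltrafilter hU, P y) ↔ (space U).sep P ∈ U :=
  Iff.rfl

theorem eventually_mem_space {U : ZFSet.{u}} (hU : IsUltrafilterIn Set.univ U) :
    ∀ᶠ y in toUltrafilter hU, y ∈ space U := by
  rw [eventually_toUltrafilter]
  convert! hU.space_mem using 1
  ext y
  simp

/-- `p` sends each function to the element it represents in the transitive collapse `N` of the
ultrapower of the universe by `L`. -/
structure Collapse (L : Ultrafilter ZFSet.{u}) (N : Set ZFSet.{u})
    (p : (ZFSet.{u} → ZFSet.{u}) → ZFSet.{u}) : Prop where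
  eq_iff : ∀ {F G}, p F = p G ↔ ∀ᶠ y in L, F y = G y
  mem_iff : ∀ {F G}, p F ∈ p G ↔ ∀ᶠ y in L, F y ∈ G y
  mem_model : ∀ F, p F ∈ N
  exists_rep : ∀ x ∈ N, ∃ F, p F = x
  transitive : ∀ x ∈ N, ∀ y ∈ x, y ∈ N

-- Passing from set-coded functions on `space U` to arbitrary maps `ZFSet → ZFSet` loses nothing,
-- because by replacement the restriction of any map to a set is a set. Łoś-type arguments can then
-- use filters directly.
open Classical in
theorem IsUltrapower.exists_collapse {U : ZFSet.{u}} (hU : IsUltrafilterIn Set.univ U)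
    {N : Set ZFSet.{u}} {π : ZFSet.{u} → ZFSet.{u}} (h : IsUltrapower Set.univ U N π) :
    ∃ p, Collapse (toUltrafilter hU) N p ∧ ∀ a, embedding U π a = p fun _ => a := by
  let m : (ZFSet.{u} → ZFSet.{u}) → ZFSet.{u} := fun F =>
    let _ : ZFSet.Definable₁ F := Classical.allZFSetDefinable _
    ZFSet.map F (space U)
  have hfun : ∀ F, ∃ Z, ZFSet.IsFunc (space U) Z (m F) := fun F => by
    let _ : ZFSet.Definable₁ F := Classical.allZFSetDefinable _
    exact ⟨ZFSet.image F (space U),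
      ZFSet.map_isFunc.2 fun z hz => ZFSet.mem_image.2 ⟨z, hz, rfl⟩⟩
  have hm : ∀ F, m F ∈ UltFun Set.univ U := fun F => ⟨Set.mem_univ _, hfun F⟩
  have happ : ∀ F, ∀ y ∈ space U, app (m F) y = F y := fun F y hy => by
    obtain ⟨Z, hZ⟩ := hfun F
    let _ : ZFSet.Definable₁ F := Classical.allZFSetDefinable _
    exact ((pair_mem_iff hZ hy).1 (ZFSet.mem_map.2 ⟨y, hy, rfl⟩)).symm
  refine ⟨fun F => π (m F), ⟨?_, ?_, ?_, ?_, h.transitive⟩, ?_⟩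
  · intro F G
    rw [h.eq_iff _ (hm F) _ (hm G), eqSet_mem_iff (hm F) (hm G), eventually_toUltrafilter]
    constructor <;> refine fun h => sep_mono hU h fun y hy => ?_ <;> simp [happ _ y hy]
  · intro F G
    rw [h.mem_iff _ (hm F) _ (hm G), memSet_mem_iff (hm F) (hm G), eventually_toUltrafilter]
    constructor <;> refine fun h => sep_mono hU h fun y hy => ?_ <;> simp [happ _ y hy]
  · exact fun F => h.image_eq ▸ Set.mem_image_of_mem _ (hm F)
  · intro x hx
    rw [← h.image_eq] at hx
    obtain ⟨f, hf, rfl⟩ := hx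
    refine ⟨app f, ?_⟩
    rw [h.eq_iff _ (hm _) _ hf, eqSet_mem_iff (hm _) hf]
    exact (eventually_toUltrafilter hU).1 ((eventually_mem_space hU).mono (happ _))
  · intro a
    have : const U a = m fun _ => a := by
      let _ : ZFSet.Definable₁ (fun _ : ZFSet.{u} => a) := Classical.allZFSetDefinable _
      ext z
      change _ ↔ z ∈ ZFSet.map (fun _ => a) (space U)
      rw [ZFSet.mem_map, const, ZFSet.mem_prod]
      simp [eq_comm]
    rw [embedding, this]

/-! ### Łoś's theorem for the set operations that are needed. -/

namespace Collapse

variable {L : Ultrafilter ZFSet.{u}} {N : Set ZFSet.{u}} {p : (ZFSet.{u} → ZFSet.{u}) → ZFSet.{u}}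

theorem mem_map_iff (C : Collapse L N p) {F : ZFSet.{u} → ZFSet.{u}} {x : ZFSet.{u}} :
    x ∈ p F ↔ ∃ G, p G = x ∧ ∀ᶠ y in L, G y ∈ F y := by
  constructor
  · intro h
    obtain ⟨G, rfl⟩ := C.exists_rep _ (C.transitive _ (C.mem_model F) _ h)
    exact ⟨G, rfl, C.mem_iff.1 h⟩
  · rintro ⟨G, rfl, h⟩
    exact C.mem_iff.2 h

/-- Extensionality in the transitive collapse: both sides have all their elements in `N`, and
elements of `N` are represented. The computations of `p` on set operations below rest on this. -/
theorem ext_subset (C : Collapse L N p) {F : ZFSet.{u} → ZFSet.{u}} {x : ZFSet.{u}}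
    (hx : ∀ y ∈ x, y ∈ N) (h : ∀ G, (∀ᶠ y in L, G y ∈ F y) ↔ p G ∈ x) : p F = x := by
  ext z
  rw [C.mem_map_iff]
  constructor
  · rintro ⟨G, rfl, hG⟩
    exact (h G).1 hG
  · intro hz
    obtain ⟨G, rfl⟩ := C.exists_rep _ (hx _ hz)
    exact ⟨G, rfl, (h G).2 hz⟩

/-- The existential step of Łoś's theorem: choosing witnesses pointwise gives a function, whose
class is the witness in `N`. -/
theorem exists_iff (C : Collapse L N p) {P : ZFSet.{u} → ZFSet.{u} → Prop}
    {Q : ZFSet.{u} → Prop} (h : ∀ G, (∀ᶠ y in L, P y (G y)) ↔ Q (p G)) :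
    (∀ᶠ y in L, ∃ x, P y x) ↔ ∃ x ∈ N, Q x := by
  constructor
  · intro hP
    obtain ⟨G, hG⟩ := hP.choice
    exact ⟨p G, C.mem_model G, (h G).1 hG⟩
  · rintro ⟨x, hx, hQ⟩
    obtain ⟨G, rfl⟩ := C.exists_rep x hx
    exact ((h G).2 hQ).mono fun y hy => ⟨_, hy⟩

theorem subset_iff (C : Collapse L N p) {F G : ZFSet.{u} → ZFSet.{u}} :
    p F ⊆ p G ↔ ∀ᶠ y in L, F y ⊆ G y := by
  constructor
  · intro h
    by_contra h'
    rw [← Ultrafilter.eventually_not] at h'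
    have : ∀ᶠ y in L, ∃ x, x ∈ F y ∧ x ∉ G y := h'.mono fun y hy => by
      by_contra! hne
      exact hy fun x hx => hne x hx
    obtain ⟨H, hH⟩ := this.choice
    have h1 := h (C.mem_iff.2 (hH.mono fun _ hy => hy.1))
    obtain ⟨y, hy⟩ := ((C.mem_iff.1 h1).and hH).exists
    exact hy.2.2 hy.1
  · intro h x hx
    obtain ⟨H, rfl, hH⟩ := C.mem_map_iff.1 hx
    exact C.mem_iff.2 ((h.and hH).mono fun y hy => hy.1 hy.2)

theorem map_sep (C : Collapse L N p) {S : ZFSet.{u} → ZFSet.{u}}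
    {P : ZFSet.{u} → ZFSet.{u} → Prop} {Q : ZFSet.{u} → Prop}
    (h : ∀ G, p G ∈ p S → ((∀ᶠ y in L, P y (G y)) ↔ Q (p G))) :
    p (fun y => (S y).sep (P y)) = (p S).sep Q := by
  refine C.ext_subset (fun y hy => C.transitive _ (C.mem_model S) _ (ZFSet.mem_sep.1 hy).1)
    fun G => ?_
  simp only [ZFSet.mem_sep, eventually_and, ← C.mem_iff]
  exact and_congr_right fun hG => h G hG

theorem map_diff (C : Collapse L N p) (F G : ZFSet.{u} → ZFSet.{u}) :
    p (fun y => F y \ G y) = p F \ p G := by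
  refine C.ext_subset (fun y hy => C.transitive _ (C.mem_model F) _ (ZFSet.mem_sdiff.1 hy).1)
    fun H => ?_
  simp only [ZFSet.mem_sdiff, eventually_and, Ultrafilter.eventually_not, ← C.mem_iff]

theorem map_sUnion (C : Collapse L N p) (F : ZFSet.{u} → ZFSet.{u}) :
    p (fun y => ZFSet.sUnion (F y)) = ZFSet.sUnion (p F) := by
  have hN : ∀ z ∈ p F, z ∈ N := C.transitive _ (C.mem_model F)
  refine C.ext_subset (fun y hy => ?_) fun G => ?_
  · obtain ⟨z, hz, hy⟩ := ZFSet.mem_sUnion.1 hy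
    exact C.transitive _ (hN z hz) _ hy
  · simp only [ZFSet.mem_sUnion]
    rw [C.exists_iff (Q := fun x => x ∈ p F ∧ p G ∈ x)
      fun H => by rw [eventually_and, C.mem_iff, C.mem_iff]]
    exact ⟨fun ⟨x, _, hx⟩ => ⟨x, hx⟩, fun ⟨x, hx⟩ => ⟨x, hN x hx.1, hx⟩⟩

theorem map_upair (C : Collapse L N p) (F G : ZFSet.{u} → ZFSet.{u}) :
    p (fun y => {F y, G y}) = {p F, p G} := by
  refine C.ext_subset (fun y hy => ?_) fun H => ?_
  · rcases ZFSet.mem_pair.1 hy with rfl | rfl <;> exact C.mem_model _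
  · simp only [ZFSet.mem_pair, Ultrafilter.eventually_or, ← C.eq_iff]

theorem map_singleton (C : Collapse L N p) (F : ZFSet.{u} → ZFSet.{u}) :
    p (fun y => {F y}) = {p F} := by
  simpa [ZFSet.pair_eq_singleton] using C.map_upair F F

theorem map_pair (C : Collapse L N p) (F G : ZFSet.{u} → ZFSet.{u}) :
    p (fun y => ZFSet.pair (F y) (G y)) = ZFSet.pair (p F) (p G) := by
  simp only [ZFSet.pair]
  rw [C.map_upair, C.map_singleton, C.map_upair]

theorem map_prod (C : Collapse L N p) (F G : ZFSet.{u} → ZFSet.{u}) :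
    p (fun y => (F y).prod (G y)) = (p F).prod (p G) := by
  have hN : ∀ H, ∀ z ∈ p H, z ∈ N := fun H => C.transitive _ (C.mem_model H)
  refine C.ext_subset (fun y hy => ?_) fun H => ?_
  · obtain ⟨a, ha, b, hb, rfl⟩ := ZFSet.mem_prod.1 hy
    obtain ⟨A, rfl⟩ := C.exists_rep a (hN _ a ha)
    obtain ⟨B, rfl⟩ := C.exists_rep b (hN _ b hb)
    rw [← C.map_pair]
    exact C.mem_model _
  · have h1 : ∀ A, (∀ᶠ y in L, ∃ b, A y ∈ F y ∧ b ∈ G y ∧ H y = ZFSet.pair (A y) b) ↔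
        ∃ b ∈ N, p A ∈ p F ∧ b ∈ p G ∧ p H = ZFSet.pair (p A) b := fun A =>
      C.exists_iff (Q := fun b => p A ∈ p F ∧ b ∈ p G ∧ p H = ZFSet.pair (p A) b) fun B => by
        rw [eventually_and, eventually_and, C.mem_iff, C.mem_iff, ← C.map_pair, C.eq_iff]
    have h2 := C.exists_iff (P := fun y a => ∃ b, a ∈ F y ∧ b ∈ G y ∧ H y = ZFSet.pair a b)
      (Q := fun a => ∃ b ∈ N, a ∈ p F ∧ b ∈ p G ∧ p H = ZFSet.pair a b) h1
    simp only [ZFSet.mem_prod]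
    calc _ ↔ ∀ᶠ y in L, ∃ a b, a ∈ F y ∧ b ∈ G y ∧ H y = ZFSet.pair a b := by
          simp only [exists_and_left]
      _ ↔ _ := h2
      _ ↔ _ := ⟨fun ⟨a, _, b, _, ha, hb, h⟩ => ⟨a, ha, b, hb, h⟩,
          fun ⟨a, ha, b, hb, h⟩ => ⟨a, hN _ a ha, b, hN _ b hb, ha, hb, h⟩⟩

theorem map_const (C : Collapse L N p) (F G : ZFSet.{u} → ZFSet.{u}) :
    p (fun y => const (F y) (G y)) = const (p F) (p G) := by
  simp only [const, space]
  rw [C.map_prod, C.map_sUnion, C.map_singleton]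

theorem fst_snd_mem (C : Collapse L N p) {a b : ZFSet.{u}} (h : ZFSet.pair a b ∈ N) :
    a ∈ N ∧ b ∈ N := by
  have h1 : ({a, b} : ZFSet.{u}) ∈ N := C.transitive _ h _ (by simp [ZFSet.pair])
  exact ⟨C.transitive _ h1 _ (by simp), C.transitive _ h1 _ (by simp)⟩

/-- Pointwise separation by a relation between the values of two functions. -/
theorem map_sep_values (C : Collapse L N p) {R : ZFSet.{u} → ZFSet.{u} → Prop}
    (hR : ∀ A B, (∀ᶠ y in L, R (A y) (B y)) ↔ R (p A) (p B)) (Y F G : ZFSet.{u} → ZFSet.{u}) :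
    p (fun y => (Y y).sep fun z => ∃ a b, ZFSet.pair z a ∈ F y ∧ ZFSet.pair z b ∈ G y ∧ R a b) =
      (p Y).sep fun z => ∃ a b, ZFSet.pair z a ∈ p F ∧ ZFSet.pair z b ∈ p G ∧ R a b := by
  have hN : ∀ H z a, ZFSet.pair z a ∈ p H → a ∈ N := fun H z a h =>
    (C.fst_snd_mem (C.transitive _ (C.mem_model H) _ h)).2
  refine C.map_sep fun Z _ => ?_
  have h1 : ∀ A, (∀ᶠ y in L, ∃ b, ZFSet.pair (Z y) (A y) ∈ F y ∧ ZFSet.pair (Z y) b ∈ G y ∧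
      R (A y) b) ↔ ∃ b ∈ N, ZFSet.pair (p Z) (p A) ∈ p F ∧ ZFSet.pair (p Z) b ∈ p G ∧
      R (p A) b := fun A =>
    C.exists_iff (Q := fun b => ZFSet.pair (p Z) (p A) ∈ p F ∧ ZFSet.pair (p Z) b ∈ p G ∧
      R (p A) b) fun B => by
        rw [eventually_and, eventually_and, hR, ← C.map_pair, ← C.map_pair, C.mem_iff, C.mem_iff]
  have h2 := C.exists_iff (P := fun y a => ∃ b, ZFSet.pair (Z y) a ∈ F y ∧
      ZFSet.pair (Z y) b ∈ G y ∧ R a b)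
    (Q := fun a => ∃ b ∈ N, ZFSet.pair (p Z) a ∈ p F ∧ ZFSet.pair (p Z) b ∈ p G ∧ R a b) h1
  exact h2.trans ⟨fun ⟨a, _, b, _, h⟩ => ⟨a, b, h⟩,
    fun ⟨a, b, h⟩ => ⟨a, hN _ _ _ h.1, b, hN _ _ _ h.2.1, h⟩⟩

theorem map_memSet (C : Collapse L N p) (Y F G : ZFSet.{u} → ZFSet.{u}) :
    p (fun y => memSet (Y y) (F y) (G y)) = memSet (p Y) (p F) (p G) :=
  C.map_sep_values (R := (· ∈ ·)) (fun _ _ => C.mem_iff.symm) Y F G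

theorem map_eqSet (C : Collapse L N p) (Y F G : ZFSet.{u} → ZFSet.{u}) :
    p (fun y => eqSet (Y y) (F y) (G y)) = eqSet (p Y) (p F) (p G) :=
  C.map_sep_values (R := (· = ·)) (fun _ _ => C.eq_iff.symm) Y F G

end Collapse

/-! ### Normal ultrafilters -/

/-- `L` is closed under intersections of families indexed by `X`. -/
def CompleteOver (L : Ultrafilter ZFSet.{u}) (X : ZFSet.{u}) : Prop :=
  ∀ P : ZFSet.{u} → ZFSet.{u} → Prop, (∀ x ∈ X, ∀ᶠ y in L, P x y) → ∀ᶠ y in L, ∀ x ∈ X, P x y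

theorem CompleteOver.exists_eventually_eq {L : Ultrafilter ZFSet.{u}} {X : ZFSet.{u}}
    (h : CompleteOver L X) {F : ZFSet.{u} → ZFSet.{u}} (hF : ∀ᶠ y in L, F y ∈ X) :
    ∃ x ∈ X, ∀ᶠ y in L, F y = x := by
  by_contra! hne
  have := h (fun x y => F y ≠ x) fun x hx => hne x hx
  obtain ⟨y, hy⟩ := (this.and hF).exists
  exact hy.1 _ hy.2 rfl

/-- If the intersection failed, choosing an index of failure at each point would give an `X`-valued
function. Its almost constant value contradicts the hypothesis at that index. -/
theorem completeOver_of_exists_eventually_eq {L : Ultrafilter ZFSet.{u}} {X : ZFSet.{u}}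
    (h : ∀ F : ZFSet.{u} → ZFSet.{u}, (∀ᶠ y in L, F y ∈ X) → ∃ x ∈ X, ∀ᶠ y in L, F y = x) :
    CompleteOver L X := by
  intro P hP
  by_contra hne
  have h1 : ∀ᶠ y in L, ∃ x, x ∈ X ∧ ¬ P x y :=
    (Ultrafilter.eventually_not.2 hne).mono fun y hy => by simpa using hy
  obtain ⟨F, hF⟩ := h1.choice
  obtain ⟨x, hx, hFx⟩ := h F (hF.mono fun _ hy => hy.1)
  obtain ⟨y, hy⟩ := ((hP x hx).and (hFx.and hF)).exists
  exact hy.2.2.2 (hy.2.1 ▸ hy.1)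

/-- The ultrafilter decides `x ∈ F y` separately for each `x ∈ X`, and completeness over `X` makes
all the decisions hold at once. This replaces the cardinal arithmetic showing that a measurable
cardinal is a strong limit. -/
theorem CompleteOver.powerset {L : Ultrafilter ZFSet.{u}} {X : ZFSet.{u}}
    (h : CompleteOver L X) : CompleteOver L (ZFSet.powerset X) := by
  refine completeOver_of_exists_eventually_eq fun F hF => ?_
  let A := X.sep fun x => ∀ᶠ y in L, x ∈ F y
  have h1 := h (fun x y => x ∈ F y ↔ x ∈ A) fun x hx => by
    by_cases hxA : x ∈ A
    · exact (ZFSet.mem_sep.1 hxA).2.mono fun y hy => by simp [hxA, hy]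
    · have : ¬ ∀ᶠ y in L, x ∈ F y := fun h' => hxA (ZFSet.mem_sep.2 ⟨hx, h'⟩)
      exact (Ultrafilter.eventually_not.2 this).mono fun y hy => by simp [hxA, hy]
  refine ⟨A, ZFSet.mem_powerset.2 fun x hx => (ZFSet.mem_sep.1 hx).1, ?_⟩
  filter_upwards [h1, hF] with y hy hFy
  ext x
  by_cases hx : x ∈ X
  · exact hy x hx
  · exact ⟨fun h' => (hx (ZFSet.mem_powerset.1 hFy h')).elim,
      fun h' => (hx (ZFSet.mem_sep.1 h').1).elim⟩

/-- `L` is induced by a normal ultrafilter on the ordinal `κ`. -/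
structure NormalOn (κ : ZFSet.{u}) (L : Ultrafilter ZFSet.{u}) : Prop where
  ordinal : κ.IsOrdinal
  eventually_mem : ∀ᶠ y in L, y ∈ κ
  not_eventually_eq : ∀ β ∈ κ, ¬ ∀ᶠ y in L, y = β
  complete : ∀ α ∈ κ, CompleteOver L α
  normal : ∀ F : ZFSet.{u} → ZFSet.{u}, (∀ᶠ y in L, F y ∈ y) → ∃ β ∈ κ, ∀ᶠ y in L, F y = β

theorem IsNormalUltrafilter.normalOn {κ U : ZFSet.{u}} (hκ : κ.IsOrdinal)
    (h : IsNormalUltrafilter κ U) : NormalOn κ (toUltrafilter h.toIsUltrafilterIn) := by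
  have hsp := h.space_eq
  refine ⟨hκ, ?_, ?_, ?_, ?_⟩
  · exact (eventually_mem_space _).mono fun y hy => hsp ▸ hy
  · intro β hβ h'
    apply h.nonprincipal β hβ
    rw [eventually_toUltrafilter, hsp] at h'
    convert! h' using 1
    ext y
    simp only [ZFSet.mem_singleton, ZFSet.mem_sep]
    exact ⟨fun hy => ⟨hy ▸ hβ, hy⟩, fun hy => hy.2⟩
  · intro α hα P hP
    rw [eventually_toUltrafilter, hsp]
    have := h.complete α hα (fun β => κ.sep (P β)) fun β hβ => by
      have := hP β hβ
      rwa [eventually_toUltrafilter, hsp] at this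
    rw [← hsp] at this ⊢
    exact sep_mono h.toIsUltrafilterIn this fun y _ hy β hβ => (ZFSet.mem_sep.1 (hy β hβ)).2
  · intro F hF
    rw [eventually_toUltrafilter, hsp] at hF
    obtain ⟨β, hβ, h'⟩ := h.normal F hF
    refine ⟨β, hβ, ?_⟩
    rwa [eventually_toUltrafilter, hsp]

theorem IsNormalUltrafilter.mem_iff {κ U A : ZFSet.{u}} (h : IsNormalUltrafilter κ U) :
    A ∈ U ↔ A ⊆ κ ∧ ∀ᶠ y in toUltrafilter h.toIsUltrafilterIn, y ∈ A := by
  rw [eventually_toUltrafilter, h.space_eq]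
  have key : A ⊆ κ → κ.sep (· ∈ A) = A := fun hA => by
    ext y
    rw [ZFSet.mem_sep]
    exact ⟨fun hy => hy.2, fun hy => ⟨hA hy, hy⟩⟩
  constructor
  · intro hA
    have hs : A ⊆ κ := h.space_eq ▸ subset_space hA
    exact ⟨hs, (key hs).symm ▸ hA⟩
  · rintro ⟨hs, hA⟩
    exact key hs ▸ hA

theorem mem_toZFSet_omega0 {x : ZFSet.{u}} (hx : x ∈ ZFSet.omega) :
    x ∈ Ordinal.toZFSet Ordinal.omega0 := by
  have hn : ∀ n : ℕ, ZFSet.mk (PSet.ofNat n) = Ordinal.toZFSet.{u} n := by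
    intro n
    induction n with
    | zero => simp [PSet.ofNat]; rfl
    | succ n ih =>
      rw [Nat.cast_succ, Ordinal.toZFSet_add_one, ← ih]
      rfl
  induction x using Quotient.ind with
  | _ x =>
    obtain ⟨⟨n⟩, hx⟩ : x ∈ PSet.omega := hx
    have : ZFSet.mk x = ZFSet.mk (PSet.ofNat n) := Quotient.sound hx
    change ZFSet.mk x ∈ _
    rw [this, hn, Ordinal.toZFSet_mem_toZFSet_iff]
    exact Ordinal.natCast_lt_omega0 n

theorem IsNormalUltrafilter.isCountablyCompleteIn {κ U : ZFSet.{u}}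
    (hκ : IsMeasurableCardinal κ) (h : IsNormalUltrafilter κ U) :
    IsCountablyCompleteIn Set.univ U := by
  have hN := h.normalOn hκ.ordinal
  have homega : Ordinal.toZFSet Ordinal.omega0 ∈ κ := by
    have h1 := hκ.uncountable
    rw [← hκ.ordinal.toZFSet_rank_eq, Ordinal.card_toZFSet] at h1
    rw [← hκ.ordinal.toZFSet_rank_eq, Ordinal.toZFSet_mem_toZFSet_iff]
    by_contra! h2
    have := Ordinal.card_le_card h2
    rw [Ordinal.card_omega0] at this
    exact absurd h1 this.not_gt
  refine ⟨h.toIsUltrafilterIn, fun s _ hs => ?_⟩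
  refine (eventually_toUltrafilter h.toIsUltrafilterIn).1 ?_
  -- Completeness is applied over the von Neumann ordinal ω. The guard `n ∈ ZFSet.omega` makes the
  -- single inclusion `mem_toZFSet_omega0` sufficient.
  have h1 := hN.complete _ homega (fun n y => n ∈ ZFSet.omega → y ∈ app s n) fun n _ => by
    by_cases hn : n ∈ ZFSet.omega
    · have h2 : app s n ∈ U :=
        (ZFSet.pair_mem_prod.1 (hs.1 ((pair_mem_iff hs hn).2 rfl))).2
      exact (h.mem_iff.1 h2).2.mono fun y hy _ => hy
    · exact Eventually.of_forall fun y hy => (hn hy).elim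
  refine h1.mono fun y hy n A hnA => ?_
  have hn : n ∈ ZFSet.omega := (ZFSet.pair_mem_prod.1 (hs.1 hnA)).1
  rw [(pair_mem_iff hs hn).1 hnA]
  exact hy n (mem_toZFSet_omega0 hn) hn

theorem NormalOn.eventually_gt {L : Ultrafilter ZFSet.{u}} {κ : ZFSet.{u}} (hL : NormalOn κ L)
    {β : ZFSet.{u}} (hβ : β ∈ κ) : ∀ᶠ y : ZFSet.{u} in L, β ∈ y := by
  have h1 : ¬ ∀ᶠ y in L, y ∈ β := fun h => by
    obtain ⟨x, hx, hy⟩ := (hL.complete β hβ).exists_eventually_eq (F := fun y => y) h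
    exact hL.not_eventually_eq x (hL.ordinal.mem_trans hx hβ) hy
  filter_upwards [Ultrafilter.eventually_not.2 h1,
    Ultrafilter.eventually_not.2 (hL.not_eventually_eq β hβ), hL.eventually_mem] with y h1 h2 h3
  have := (hL.ordinal.mem h3).mem_trichotomous (hL.ordinal.mem hβ)
  tauto

/-! ### The ultrapower by a normal ultrafilter. -/

namespace Collapse

variable {L : Ultrafilter ZFSet.{u}} {N : Set ZFSet.{u}} {p : (ZFSet.{u} → ZFSet.{u}) → ZFSet.{u}}

/-- A function into `S` is almost constant, so completeness over `X` prevents `j(S)` from acquiring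
new elements. -/
theorem map_eq_of_completeOver (C : Collapse L N p) {X S : ZFSet.{u}} (hX : CompleteOver L X)
    (hfix : ∀ x ∈ X, p (fun _ => x) = x) (hS : S ⊆ X) : p (fun _ => S) = S := by
  ext x
  constructor
  · intro hx
    obtain ⟨G, rfl, hG⟩ := C.mem_map_iff.1 hx
    obtain ⟨z, hz, hGz⟩ := hX.exists_eventually_eq (hG.mono fun _ hy => hS hy)
    obtain ⟨y, hy⟩ := (hG.and hGz).exists
    rw [C.eq_iff.2 hGz, hfix z hz, ← hy.2]
    exact hy.1
  · intro hx
    rw [← hfix x (hS hx)]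
    exact C.mem_iff.2 (Eventually.of_forall fun _ => hx)

variable {κ : ZFSet.{u}}

theorem map_of_mem (C : Collapse L N p) (hL : NormalOn κ L) {β : ZFSet.{u}} (hβ : β ∈ κ) :
    p (fun _ => β) = β := by
  induction β using ZFSet.inductionOn with
  | _ β ih =>
    exact C.map_eq_of_completeOver (hL.complete β hβ)
      (fun x hx => ih x hx (hL.ordinal.mem_trans hx hβ)) fun _ h => h

theorem map_of_subset_of_mem (C : Collapse L N p) (hL : NormalOn κ L) {β A : ZFSet.{u}}
    (hβ : β ∈ κ) (hA : A ⊆ β) : p (fun _ => A) = A :=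
  C.map_eq_of_completeOver (hL.complete β hβ)
    (fun _ hx => C.map_of_mem hL (hL.ordinal.mem_trans hx hβ)) hA

theorem map_of_subset_powerset (C : Collapse L N p) (hL : NormalOn κ L) {β A : ZFSet.{u}}
    (hβ : β ∈ κ) (hA : A ⊆ ZFSet.powerset β) : p (fun _ => A) = A :=
  C.map_eq_of_completeOver (hL.complete β hβ).powerset
    (fun _ hx => C.map_of_subset_of_mem hL hβ (ZFSet.mem_powerset.1 hx)) hA

/-- A function with values in `A ∩ y` is regressive, hence almost constant by normality, and `p`
fixes its constant value. Conversely, each element of `A` is eventually below `y`. -/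
theorem map_inter_id (C : Collapse L N p) (hL : NormalOn κ L) {A : ZFSet.{u}} (hA : A ⊆ κ) :
    p (fun y => A ∩ y) = A := by
  ext x
  constructor
  · intro hx
    obtain ⟨G, rfl, hG⟩ := C.mem_map_iff.1 hx
    obtain ⟨β, hβ, hGβ⟩ := hL.normal G (hG.mono fun _ hy => (ZFSet.mem_inter.1 hy).2)
    obtain ⟨y, hy⟩ := (hG.and hGβ).exists
    rw [C.eq_iff.2 hGβ, C.map_of_mem hL hβ, ← hy.2]
    exact (ZFSet.mem_inter.1 hy.1).1
  · intro hx
    rw [← C.map_of_mem hL (hA hx)]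
    exact C.mem_iff.2 ((hL.eventually_gt (hA hx)).mono fun y hy => ZFSet.mem_inter.2 ⟨hx, hy⟩)

theorem map_id (C : Collapse L N p) (hL : NormalOn κ L) : p (fun y => y) = κ := by
  rw [← C.map_inter_id hL (A := κ) fun _ h => h, C.eq_iff]
  filter_upwards [hL.eventually_mem] with y hy
  ext z
  rw [ZFSet.mem_inter]
  exact ⟨fun hz => ⟨hL.ordinal.mem_trans hz hy, hz⟩, fun hz => hz.2⟩

theorem subset_mem_model (C : Collapse L N p) (hL : NormalOn κ L) {A : ZFSet.{u}} (hA : A ⊆ κ) :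
    A ∈ N := C.map_inter_id hL hA ▸ C.mem_model _

theorem eventually_eq_inter (C : Collapse L N p) (hL : NormalOn κ L) {F : ZFSet.{u} → ZFSet.{u}}
    (hF : p F ⊆ κ) : ∀ᶠ y in L, F y = p F ∩ y :=
  C.eq_iff.1 (C.map_inter_id hL hF).symm

theorem subset_iff_eventually_subset (C : Collapse L N p) (hL : NormalOn κ L)
    {F : ZFSet.{u} → ZFSet.{u}} : p F ⊆ κ ↔ ∀ᶠ y in L, F y ⊆ y := by
  rw [← C.subset_iff, C.map_id hL]

theorem eventually_mem_iff (C : Collapse L N p) (hL : NormalOn κ L) {A : ZFSet.{u}} :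
    (∀ᶠ y in L, y ∈ A) ↔ κ ∈ p fun _ => A := by
  rw [← C.mem_iff, C.map_id hL]

theorem mem_map_const_iff (C : Collapse L N p) (hL : NormalOn κ L) {A β : ZFSet.{u}}
    (hβ : β ∈ κ) : (β ∈ p fun _ => A) ↔ β ∈ A := by
  nth_rw 1 [← C.map_of_mem hL hβ]
  rw [C.mem_iff]
  simp

end Collapse

/-! ### The Mitchell order on normal ultrafilters -/

/-- The diagonal set for irreflexivity, built by ∈-recursion: whether `y` enters depends only on the
part of the set already decided below `y`. -/
theorem exists_mem_eq_sep_notMem (F : ZFSet.{u} → ZFSet.{u}) :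
    ∃ T : ZFSet.{u} → Prop, ∀ y, T y ↔ y.sep T ∉ F y := by
  classical
  let T : ZFSet.{u} → Prop := ZFSet.mem_wf.fix fun y ih =>
    y.sep (fun z => ∃ h : z ∈ y, ih z h) ∉ F y
  refine ⟨T, fun y => ?_⟩
  have h1 : T y = (y.sep (fun z => ∃ _ : z ∈ y, T z) ∉ F y) := ZFSet.mem_wf.fix_eq _ y
  have h2 : y.sep (fun z => ∃ _ : z ∈ y, T z) = y.sep T := by
    ext z
    simp only [ZFSet.mem_sep]
    exact ⟨fun ⟨h, _, h'⟩ => ⟨h, h'⟩, fun ⟨h, h'⟩ => ⟨h, h, h'⟩⟩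
  rw [h1, h2]

/-- If `F` represented `U`, the diagonal set `A` would satisfy `A ∈ U` iff `A ∩ y ∈ F y` for almost
all `y` iff `y ∉ A` for almost all `y`, that is, iff `A ∉ U`. -/
theorem not_mitchellLT_self {κ U : ZFSet.{u}} (hκ : κ.IsOrdinal) (h : IsNormalUltrafilter κ U) :
    ¬ MitchellLT U U := by
  rintro ⟨N, π, hπ, hUN⟩
  obtain ⟨p, C, -⟩ := hπ.exists_collapse h.toIsUltrafilterIn
  have hL := h.normalOn hκ
  obtain ⟨F, hF⟩ := C.exists_rep U hUN
  obtain ⟨T, hT⟩ := exists_mem_eq_sep_notMem F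
  have hA : κ.sep T ⊆ κ := fun y hy => (ZFSet.mem_sep.1 hy).1
  have h1 : κ.sep T ∈ U ↔ ∀ᶠ y in toUltrafilter h.toIsUltrafilterIn, κ.sep T ∩ y ∈ F y := by
    rw [← C.mem_iff, hF, C.map_inter_id hL hA]
  have h2 : (∀ᶠ y in toUltrafilter h.toIsUltrafilterIn, κ.sep T ∩ y ∈ F y) ↔
      ∀ᶠ y in toUltrafilter h.toIsUltrafilterIn, ¬ y ∈ κ.sep T := by
    refine eventually_congr (hL.eventually_mem.mono fun y hy => ?_)
    have : κ.sep T ∩ y = y.sep T := by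
      ext z
      simp only [ZFSet.mem_inter, ZFSet.mem_sep]
      exact ⟨fun hz => ⟨hz.2, hz.1.2⟩, fun hz => ⟨⟨hκ.mem_trans hz.1 hy, hz.2⟩, hz.1⟩⟩
    rw [this, ZFSet.mem_sep, hT y]
    tauto
  rw [h2, Ultrafilter.eventually_not, h.mem_iff] at h1
  tauto

/-- Since `U₀` consists of subsets of `κ₀ < κ₁`, the embedding fixes it, so `U₀ = j(U₀) ∈ N`. -/
theorem mitchellLT_of_mem {κ₀ κ₁ U₀ U₁ : ZFSet.{u}} (hκ₁ : IsMeasurableCardinal κ₁)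
    (h₀ : IsNormalUltrafilter κ₀ U₀) (h₁ : IsNormalUltrafilter κ₁ U₁) (h : κ₀ ∈ κ₁) :
    MitchellLT U₀ U₁ := by
  obtain ⟨N, π, hπ⟩ := exists_isUltrapower (h₁.isCountablyCompleteIn hκ₁)
  obtain ⟨p, C, -⟩ := hπ.exists_collapse h₁.toIsUltrafilterIn
  refine ⟨N, π, hπ, ?_⟩
  rw [← C.map_of_subset_powerset (h₁.normalOn hκ₁.ordinal) h fun A hA =>
    ZFSet.mem_powerset.2 (h₀.mem_iff.1 hA).1]
  exact C.mem_model _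

theorem Collapse.isOrdinal {L : Ultrafilter ZFSet.{u}} {N : Set ZFSet.{u}}
    {p : (ZFSet.{u} → ZFSet.{u}) → ZFSet.{u}} (C : Collapse L N p) {F : ZFSet.{u} → ZFSet.{u}}
    (hF : ∀ᶠ y in L, (F y).IsOrdinal) : (p F).IsOrdinal := by
  refine ⟨fun x hx z hz => ?_, fun {z x w} hz hx hw => ?_⟩
  · obtain ⟨G, rfl, hG⟩ := C.mem_map_iff.1 hx
    obtain ⟨H, rfl, hH⟩ := C.mem_map_iff.1 hz
    refine C.mem_iff.2 ?_
    filter_upwards [hF, hG, hH] with y h1 h2 h3 using h1.mem_trans h3 h2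
  · obtain ⟨G, rfl, hG⟩ := C.mem_map_iff.1 hw
    obtain ⟨H, rfl, hH⟩ := C.mem_map_iff.1 hx
    obtain ⟨K, rfl, hK⟩ := C.mem_map_iff.1 hz
    refine C.mem_iff.2 ?_
    filter_upwards [hF, hG, hH, hK] with y h1 h2 h3 h4 using h1.mem_trans' h4 h3 h2

/-- Every set is well-ordered by an injection onto an initial segment of the ordinals. -/
theorem exists_ordinal_coding (X : ZFSet.{u}) : ∃ c : ZFSet.{u} → ZFSet.{u},
    (∀ x, (c x).IsOrdinal) ∧ (∀ x ∈ X, ∀ x' ∈ X, c x = c x' → x = x') ∧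
    ∀ x ∈ X, ∀ ξ ∈ c x, ∃ x' ∈ X, c x' = ξ := by
  classical
  let T := Shrink.{u} X
  let r : T → T → Prop := WellOrderingRel
  let c : ZFSet.{u} → ZFSet.{u} := fun x =>
    if hx : x ∈ X then (Ordinal.typein r (equivShrink X ⟨x, hx⟩)).toZFSet else ∅
  have hc : ∀ x (hx : x ∈ X), c x = (Ordinal.typein r (equivShrink X ⟨x, hx⟩)).toZFSet :=
    fun x hx => dif_pos hx
  refine ⟨c, fun x => ?_, fun x hx x' hx' h => ?_, fun x hx ξ hξ => ?_⟩
  · by_cases hx : x ∈ X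
    · rw [hc x hx]
      exact ZFSet.isOrdinal_toZFSet _
    · simp [c, hx]
  · rw [hc x hx, hc x' hx'] at h
    simpa using Ordinal.typein_injective r (Ordinal.toZFSet_injective h)
  · rw [hc x hx] at hξ
    obtain ⟨a, ha, rfl⟩ := Ordinal.mem_toZFSet_iff.1 hξ
    obtain ⟨t, rfl⟩ := Ordinal.typein_surj r (ha.trans (Ordinal.typein_lt_type r _))
    refine ⟨((equivShrink X).symm t).1, ((equivShrink X).symm t).2, ?_⟩
    rw [hc _ ((equivShrink X).symm t).2]
    simp

/-- If `κ₁ < κ₀`, the model contains every subset of `κ₀`, and it can code the subsets of `κ₁` by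
ordinals below `κ₀`. Then `U₁` is coded by a subset of `κ₀`, so it lies in its own ultrapower. -/
theorem notMem_of_mitchellLT {κ₀ κ₁ U₀ U₁ : ZFSet.{u}} (hκ₀ : κ₀.IsOrdinal) (hκ₁ : κ₁.IsOrdinal)
    (h₀ : IsNormalUltrafilter κ₀ U₀) (h₁ : IsNormalUltrafilter κ₁ U₁) (h : MitchellLT U₀ U₁) :
    κ₁ ∉ κ₀ := by
  intro hlt
  obtain ⟨N, π, hπ, hUN⟩ := h
  refine not_mitchellLT_self hκ₁ h₁ ⟨N, π, hπ, ?_⟩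
  obtain ⟨p, C, -⟩ := hπ.exists_collapse h₁.toIsUltrafilterIn
  have hL₀ := h₀.normalOn hκ₀
  have hL₁ := h₁.normalOn hκ₁
  -- One of `A` and its complement belongs to `U₀ ∈ N`, and `N` is closed under differences.
  have hsub : ∀ A ⊆ κ₀, A ∈ N := by
    intro A hA
    rcases h₀.ultra A (Set.mem_univ _) (h₀.space_eq.symm ▸ hA) with hA' | hA'
    · exact C.transitive _ hUN _ hA'
    · obtain ⟨F, hF⟩ := C.exists_rep _ (C.transitive _ hUN _ hA')
      obtain ⟨G, hG⟩ := C.exists_rep _ (C.transitive _ hUN _ h₀.space_mem)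
      have : A = space U₀ \ (space U₀ \ A) := by
        ext z
        simp only [ZFSet.mem_sdiff, h₀.space_eq]
        have := @hA z
        tauto
      rw [this, ← hF, ← hG, ← C.map_diff]
      exact C.mem_model _
  choose c hord hinj hsurj using fun y : ZFSet.{u} => exists_ordinal_coding (ZFSet.powerset y)
  -- `D` is the coding of the subsets of `κ₁` that `N` obtains from the pointwise codings `c y`. By
  -- `hDsurj` its values are closed downwards.
  let D : ZFSet.{u} → ZFSet.{u} := fun A => p fun y => c y (A ∩ y)
  have hDord : ∀ A, (D A).IsOrdinal := fun A => C.isOrdinal (Eventually.of_forall fun y => hord _ _)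
  have hDinj : ∀ A ⊆ κ₁, ∀ A' ⊆ κ₁, D A = D A' → A = A' := by
    intro A hA A' hA' hAA'
    rw [← C.map_inter_id hL₁ hA, ← C.map_inter_id hL₁ hA', C.eq_iff]
    refine (C.eq_iff.1 hAA').mono fun y hy => hinj y _ ?_ _ ?_ hy <;>
      exact ZFSet.mem_powerset.2 fun z hz => (ZFSet.mem_inter.1 hz).2
  have hDeq : ∀ G, p G ⊆ κ₁ → D (p G) = p fun y => c y (G y) := fun G hG =>
    C.eq_iff.2 ((C.eventually_eq_inter hL₁ hG).mono fun y hy => by simp only [← hy])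
  have hDsurj : ∀ A, ∀ ξ ∈ D A, ∃ A' ⊆ κ₁, D A' = ξ := by
    intro A ξ hξ
    obtain ⟨G, rfl, hG⟩ := C.mem_map_iff.1 hξ
    have h1 : ∀ᶠ y in toUltrafilter h₁.toIsUltrafilterIn, ∃ x, x ⊆ y ∧ c y x = G y :=
      hG.mono fun y hy => by
        obtain ⟨x, hx, hxy⟩ := hsurj y _
          (ZFSet.mem_powerset.2 fun z hz => (ZFSet.mem_inter.1 hz).2) _ hy
        exact ⟨x, ZFSet.mem_powerset.1 hx, hxy⟩
    obtain ⟨H, hH⟩ := h1.choice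
    have hHκ : p H ⊆ κ₁ := (C.subset_iff_eventually_subset hL₁).2 (hH.mono fun _ hy => hy.1)
    exact ⟨p H, hHκ, (hDeq H hHκ).trans (C.eq_iff.2 (hH.mono fun _ hy => hy.2))⟩
  have hDlt : ∀ A, D A ∈ κ₀ := by
    intro A
    by_contra hA
    have hsub : κ₀ ⊆ D A := ((hDord A).notMem_iff_subset hκ₀).1 hA
    -- Otherwise every `ξ < κ₀` codes some `E ξ ⊆ κ₁`. Since `U₀` is complete over the power set of
    -- `κ₁`, `E` is almost constant; then so is `ξ = D (E ξ)`, against nonprincipality.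
    choose! E hE hDE using fun ξ (hξ : ξ ∈ κ₀) => hDsurj A ξ (hsub hξ)
    obtain ⟨B, -, hB⟩ := (hL₀.complete κ₁ hlt).powerset.exists_eventually_eq
      (hL₀.eventually_mem.mono fun ξ hξ => ZFSet.mem_powerset.2 (hE ξ hξ))
    have h2 : ∀ᶠ ξ in toUltrafilter h₀.toIsUltrafilterIn, ξ ∈ κ₀ ∧ ξ = D B := by
      filter_upwards [hB, hL₀.eventually_mem] with ξ h3 h4
      exact ⟨h4, by rw [← h3, hDE ξ h4]⟩
    obtain ⟨ξ, hξ⟩ := h2.exists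
    exact hL₀.not_eventually_eq _ (hξ.2 ▸ hξ.1) (h2.mono fun _ h => h.2)
  let B := κ₀.sep fun ξ => ∃ A ∈ U₁, D A = ξ
  obtain ⟨b, hb⟩ := C.exists_rep B (hsub B fun ξ hξ => (ZFSet.mem_sep.1 hξ).1)
  have hsubU : ∀ A ∈ U₁, A ⊆ κ₁ := fun A hA => (h₁.mem_iff.1 hA).1
  have : U₁ = p fun y => (ZFSet.powerset y).sep fun x => c y x ∈ b y := by
    symm
    refine C.ext_subset (fun A hA => C.subset_mem_model hL₁ (hsubU A hA)) fun G => ?_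
    simp only [ZFSet.mem_sep, ZFSet.mem_powerset, eventually_and]
    rw [← C.subset_iff_eventually_subset hL₁, ← C.mem_iff, hb]
    constructor
    · rintro ⟨hG, hGB⟩
      rw [← hDeq G hG] at hGB
      obtain ⟨A, hA, hAG⟩ := (ZFSet.mem_sep.1 hGB).2
      rwa [← hDinj A (hsubU A hA) _ hG hAG]
    · intro hG
      refine ⟨hsubU _ hG, ?_⟩
      rw [← hDeq G (hsubU _ hG)]
      exact ZFSet.mem_sep.2 ⟨hDlt _, _, hG, rfl⟩
  rw [this]
  exact C.mem_model _

/-- With `F` representing `U₀` and `G` representing `U₁`, `A ∈ U₀` iff `{y < κ : A ∩ y ∈ F y} ∈ U₁`.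
Replacing `κ`, `A`, `U₁` by `α`, `A ∩ α`, `G α` gives a function representing `U₀` modulo `U₂`. -/
theorem mitchellLT_trans_of_same {κ U₀ U₁ U₂ : ZFSet.{u}} (hκ : κ.IsOrdinal)
    (h₀ : IsNormalUltrafilter κ U₀) (h₁ : IsNormalUltrafilter κ U₁)
    (h₂ : IsNormalUltrafilter κ U₂) (h : MitchellLT U₀ U₁) (h' : MitchellLT U₁ U₂) :
    MitchellLT U₀ U₂ := by
  obtain ⟨N₁, π₁, hπ₁, hU₀⟩ := h
  obtain ⟨N₂, π₂, hπ₂, hU₁⟩ := h'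
  refine ⟨N₂, π₂, hπ₂, ?_⟩
  obtain ⟨p₁, C₁, -⟩ := hπ₁.exists_collapse h₁.toIsUltrafilterIn
  obtain ⟨p₂, C₂, -⟩ := hπ₂.exists_collapse h₂.toIsUltrafilterIn
  have hL₁ := h₁.normalOn hκ
  have hL₂ := h₂.normalOn hκ
  obtain ⟨F, hF⟩ := C₁.exists_rep _ hU₀
  obtain ⟨G, hG⟩ := C₂.exists_rep _ hU₁
  have hsub : ∀ A ∈ U₀, A ⊆ κ := fun A hA => (h₀.mem_iff.1 hA).1
  let S : ZFSet.{u} → ZFSet.{u} := fun A => κ.sep fun y => A ∩ y ∈ F y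
  have hS : ∀ A, S A ⊆ κ := fun A y hy => (ZFSet.mem_sep.1 hy).1
  have hmem : ∀ A ⊆ κ, (A ∈ U₀ ↔ S A ∈ U₁) := by
    intro A hA
    rw [← hF, ← C₁.map_inter_id hL₁ hA, C₁.mem_iff, C₁.map_inter_id hL₁ hA, h₁.mem_iff]
    simp only [S, ZFSet.mem_sep, eventually_and]
    exact ⟨fun h => ⟨hS A, hL₁.eventually_mem, h⟩, fun h => h.2.2⟩
  have : U₀ = p₂ fun α => (ZFSet.powerset α).sep fun x => (α.sep fun y => x ∩ y ∈ F y) ∈ G α := by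
    symm
    refine C₂.ext_subset (fun A hA => C₂.subset_mem_model hL₂ (hsub A hA)) fun H => ?_
    simp only [ZFSet.mem_sep, ZFSet.mem_powerset, eventually_and]
    rw [← C₂.subset_iff_eventually_subset hL₂]
    have key : p₂ H ⊆ κ → ((∀ᶠ α in toUltrafilter h₂.toIsUltrafilterIn,
        (α.sep fun y => H α ∩ y ∈ F y) ∈ G α) ↔ p₂ H ∈ U₀) := by
      intro hH
      rw [hmem _ hH, ← hG, ← C₂.map_inter_id hL₂ (hS _), C₂.mem_iff]
      refine eventually_congr ?_
      filter_upwards [C₂.eventually_eq_inter hL₂ hH, hL₂.eventually_mem] with α h3 h4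
      -- For `y < α` only `A ∩ y` matters, so `S A ∩ α` is determined by `A ∩ α`.
      have : (α.sep fun y => H α ∩ y ∈ F y) = S (p₂ H) ∩ α := by
        ext y
        simp only [S, ZFSet.mem_sep, ZFSet.mem_inter]
        have h5 : y ∈ α → H α ∩ y = p₂ H ∩ y := fun hy => by
          rw [h3]
          ext z
          simp only [ZFSet.mem_inter]
          exact ⟨fun hz => ⟨hz.1.1, hz.2⟩,
            fun hz => ⟨⟨hz.1, (hκ.mem h4).mem_trans hz.2 hy⟩, hz.2⟩⟩
        constructor
        · rintro ⟨hy, hyF⟩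
          exact ⟨⟨hκ.mem_trans hy h4, h5 hy ▸ hyF⟩, hy⟩
        · rintro ⟨⟨-, hyF⟩, hy⟩
          exact ⟨hy, (h5 hy).symm ▸ hyF⟩
      rw [this]
    exact ⟨fun h => (key h.1).1 h.2, fun h => ⟨hsub _ h, (key (hsub _ h)).2 h⟩⟩
  rw [this]
  exact C₂.mem_model _

theorem mitchellLT_trans {κ₀ κ₁ κ₂ U₀ U₁ U₂ : ZFSet.{u}} (hκ₀ : IsMeasurableCardinal κ₀)
    (hκ₁ : IsMeasurableCardinal κ₁) (hκ₂ : IsMeasurableCardinal κ₂)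
    (h₀ : IsNormalUltrafilter κ₀ U₀) (h₁ : IsNormalUltrafilter κ₁ U₁)
    (h₂ : IsNormalUltrafilter κ₂ U₂) (h : MitchellLT U₀ U₁) (h' : MitchellLT U₁ U₂) :
    MitchellLT U₀ U₂ := by
  have h3 := notMem_of_mitchellLT hκ₀.ordinal hκ₁.ordinal h₀ h₁ h
  have h4 := notMem_of_mitchellLT hκ₁.ordinal hκ₂.ordinal h₁ h₂ h'
  have h5 := ((hκ₁.ordinal.notMem_iff_subset hκ₀.ordinal).1 h3)
  have h6 := ((hκ₂.ordinal.notMem_iff_subset hκ₁.ordinal).1 h4)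
  rcases hκ₀.ordinal.eq_or_mem_of_subset hκ₂.ordinal (fun _ hz => h6 (h5 hz)) with rfl | hlt
  · obtain rfl : κ₀ = κ₁ := subset_antisymm h5 h6
    exact mitchellLT_trans_of_same hκ₀.ordinal h₀ h₁ h₂ h h'
  · exact mitchellLT_of_mem hκ₂ h₀ h₂ hlt

/-! ### Internal ultrapowers -/

/-- The closure properties of the class `M` which make its internal ultrapowers well behaved. -/
structure ClosedModel (M : Set ZFSet.{u}) : Prop where
  const_mem : ∀ W ∈ M, ∀ a ∈ M, const W a ∈ M
  space_mem : ∀ W ∈ M, space W ∈ M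
  memSet_mem : ∀ Y ∈ M, ∀ f ∈ M, ∀ g ∈ M, memSet Y f g ∈ M
  eqSet_mem : ∀ Y ∈ M, ∀ f ∈ M, ∀ g ∈ M, eqSet Y f g ∈ M

theorem Collapse.closedModel {L : Ultrafilter ZFSet.{u}} {N : Set ZFSet.{u}}
    {p : (ZFSet.{u} → ZFSet.{u}) → ZFSet.{u}} (C : Collapse L N p) : ClosedModel N := by
  refine ⟨fun W hW a ha => ?_, fun W hW => ?_, fun Y hY f hf g hg => ?_,
    fun Y hY f hf g hg => ?_⟩
  · obtain ⟨W, rfl⟩ := C.exists_rep W hW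
    obtain ⟨a, rfl⟩ := C.exists_rep a ha
    exact C.map_const W a ▸ C.mem_model _
  · obtain ⟨W, rfl⟩ := C.exists_rep W hW
    rw [space, ← C.map_sUnion]
    exact C.mem_model _
  · obtain ⟨Y, rfl⟩ := C.exists_rep Y hY
    obtain ⟨f, rfl⟩ := C.exists_rep f hf
    obtain ⟨g, rfl⟩ := C.exists_rep g hg
    exact C.map_memSet Y f g ▸ C.mem_model _
  · obtain ⟨Y, rfl⟩ := C.exists_rep Y hY
    obtain ⟨f, rfl⟩ := C.exists_rep f hf
    obtain ⟨g, rfl⟩ := C.exists_rep g hg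
    exact C.map_eqSet Y f g ▸ C.mem_model _

theorem isFunc_const (W a : ZFSet.{u}) : ZFSet.IsFunc (space W) {a} (const W a) := by
  refine ⟨fun z hz => hz, fun y hy => ⟨a, ?_, fun b hb => ?_⟩⟩
  · exact ZFSet.pair_mem_prod.2 ⟨hy, ZFSet.mem_singleton.2 rfl⟩
  · exact ZFSet.mem_singleton.1 (ZFSet.pair_mem_prod.1 hb).2

theorem app_const {W a y : ZFSet.{u}} (hy : y ∈ space W) : app (const W a) y = a :=
  ((pair_mem_iff (isFunc_const W a) hy).1
    (ZFSet.pair_mem_prod.2 ⟨hy, ZFSet.mem_singleton.2 rfl⟩)).symm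

theorem mem_memSet {M : Set ZFSet.{u}} {W f g y : ZFSet.{u}} (hf : f ∈ UltFun M W)
    (hg : g ∈ UltFun M W) : y ∈ memSet (space W) f g ↔ y ∈ space W ∧ app f y ∈ app g y := by
  obtain ⟨-, Z, hf⟩ := hf
  obtain ⟨-, Z', hg⟩ := hg
  rw [memSet, ZFSet.mem_sep]
  refine and_congr_right fun hy => ?_
  simp [pair_mem_iff hf hy, pair_mem_iff hg hy]

theorem mem_eqSet {M : Set ZFSet.{u}} {W f g y : ZFSet.{u}} (hf : f ∈ UltFun M W)
    (hg : g ∈ UltFun M W) : y ∈ eqSet (space W) f g ↔ y ∈ space W ∧ app f y = app g y := by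
  obtain ⟨-, Z, hf⟩ := hf
  obtain ⟨-, Z', hg⟩ := hg
  rw [eqSet, ZFSet.mem_sep]
  refine and_congr_right fun hy => ?_
  simp [pair_mem_iff hf hy, pair_mem_iff hg hy]

section Internal

variable {M : Set ZFSet.{u}} {W : ZFSet.{u}} {N : Set ZFSet.{u}} {π : ZFSet.{u} → ZFSet.{u}}

theorem const_mem_ultFun (hM : ClosedModel M) (hW : W ∈ M) {a : ZFSet.{u}} (ha : a ∈ M) :
    const W a ∈ UltFun M W :=
  ⟨hM.const_mem W hW a ha, _, isFunc_const W a⟩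

theorem embedding_mem_embedding_iff (hM : ClosedModel M) (hW : IsUltrafilterIn M W)
    (h : IsUltrapower M W N π) {a b : ZFSet.{u}} (ha : a ∈ M) (hb : b ∈ M) :
    embedding W π a ∈ embedding W π b ↔ a ∈ b := by
  have ha' := const_mem_ultFun hM hW.mem_model ha
  have hb' := const_mem_ultFun hM hW.mem_model hb
  rw [embedding, embedding, h.mem_iff _ ha' _ hb']
  by_cases hab : a ∈ b
  · have : memSet (space W) (const W a) (const W b) = space W := by
      ext y
      rw [mem_memSet ha' hb']
      exact and_iff_left_of_imp fun hy => by rwa [app_const hy, app_const hy]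
    rw [this]
    exact iff_of_true hW.space_mem hab
  · have : memSet (space W) (const W a) (const W b) = ∅ := by
      rw [ZFSet.eq_empty]
      intro y hy
      rw [mem_memSet ha' hb'] at hy
      rw [app_const hy.1, app_const hy.1] at hy
      exact hab hy.2
    rw [this]
    exact iff_of_false hW.empty_notMem hab

theorem embedding_mono (hM : ClosedModel M) (hW : IsUltrafilterIn M W)
    (h : IsUltrapower M W N π) {a b : ZFSet.{u}} (ha : a ∈ M) (hb : b ∈ M) (hab : a ⊆ b) :
    embedding W π a ⊆ embedding W π b := by
  have ha' := const_mem_ultFun hM hW.mem_model ha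
  have hb' := const_mem_ultFun hM hW.mem_model hb
  intro x hx
  have hxN := h.transitive _ (h.image_eq ▸ Set.mem_image_of_mem _ ha') _ hx
  rw [← h.image_eq] at hxN
  obtain ⟨f, hf, rfl⟩ := hxN
  refine (h.mem_iff _ hf _ hb').2 (hW.mono _ ((h.mem_iff _ hf _ ha').1 hx) _
    (hM.memSet_mem _ (hM.space_mem _ hW.mem_model) _ hf.1 _ hb'.1) ?_ ?_)
  · intro y hy
    rw [mem_memSet hf ha'] at hy
    rw [mem_memSet hf hb', app_const hy.1]
    rw [app_const hy.1] at hy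
    exact ⟨hy.1, hab hy.2⟩
  · exact fun y hy => ((mem_memSet hf hb').1 hy).1

/-- It allows `i(j(A))` to be replaced by `i(j(A) ∩ κ) = i(A)` when testing points below `i(κ)`. -/
theorem mem_embedding_inter (hM : ClosedModel M) (hW : IsUltrafilterIn M W)
    (h : IsUltrapower M W N π) {a b : ZFSet.{u}} (ha : a ∈ M) (hb : b ∈ M) (hab : a ∩ b ∈ M)
    {x : ZFSet.{u}} (hxb : x ∈ embedding W π b) :
    x ∈ embedding W π (a ∩ b) ↔ x ∈ embedding W π a := by
  have ha' := const_mem_ultFun hM hW.mem_model ha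
  have hb' := const_mem_ultFun hM hW.mem_model hb
  have hab' := const_mem_ultFun hM hW.mem_model hab
  refine ⟨fun hx => embedding_mono hM hW h hab ha (fun z hz => (ZFSet.mem_inter.1 hz).1) hx,
    fun hx => ?_⟩
  have hxN := h.transitive _ (h.image_eq ▸ Set.mem_image_of_mem _ hb') _ hxb
  rw [← h.image_eq] at hxN
  obtain ⟨f, hf, rfl⟩ := hxN
  rw [embedding, h.mem_iff _ hf _ hab']
  convert! hW.inter _ ((h.mem_iff _ hf _ ha').1 hx) _ ((h.mem_iff _ hf _ hb').1 hxb) using 1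
  ext y
  rw [ZFSet.mem_inter, mem_memSet hf hab', mem_memSet hf ha', mem_memSet hf hb']
  by_cases hy : y ∈ space W
  · simp [hy, app_const hy]
  · simp [hy]

/-- Trichotomy of the elements of a set is preserved by ultrapower embeddings. -/
theorem embedding_trichotomous (hM : ClosedModel M) (hW : IsUltrafilterIn M W)
    (h : IsUltrapower M W N π) {c : ZFSet.{u}} (hc : c ∈ M)
    (htri : ∀ a ∈ c, ∀ b ∈ c, a ∈ b ∨ a = b ∨ b ∈ a) :
    ∀ x ∈ embedding W π c, ∀ y ∈ embedding W π c, x ∈ y ∨ x = y ∨ y ∈ x := by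
  have hc' := const_mem_ultFun hM hW.mem_model hc
  have hY := hM.space_mem _ hW.mem_model
  have hrep : ∀ x ∈ embedding W π c, ∃ f ∈ UltFun M W, π f = x := fun x hx => by
    have hxN := h.transitive _ (h.image_eq ▸ Set.mem_image_of_mem _ hc') _ hx
    rwa [← h.image_eq] at hxN
  intro x hx y hy
  obtain ⟨f, hf, rfl⟩ := hrep x hx
  obtain ⟨g, hg, rfl⟩ := hrep y hy
  rw [embedding, h.mem_iff _ hf _ hc'] at hx
  rw [embedding, h.mem_iff _ hg _ hc'] at hy
  rw [h.mem_iff _ hf _ hg, h.mem_iff _ hg _ hf, h.eq_iff _ hf _ hg]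
  by_contra! hne
  have h1 := (hW.ultra _ (hM.memSet_mem _ hY _ hf.1 _ hg.1)
    fun y hy => ((mem_memSet hf hg).1 hy).1).resolve_left hne.1
  have h2 := (hW.ultra _ (hM.eqSet_mem _ hY _ hf.1 _ hg.1)
    fun y hy => ((mem_eqSet hf hg).1 hy).1).resolve_left hne.2.1
  have h3 := (hW.ultra _ (hM.memSet_mem _ hY _ hg.1 _ hf.1)
    fun y hy => ((mem_memSet hg hf).1 hy).1).resolve_left hne.2.2
  -- At a point of this intersection, two elements of `c` would be incomparable, so it is empty.
  have h4 := hW.inter _ (hW.inter _ h1 _ (hW.inter _ h2 _ h3)) _ (hW.inter _ hx _ hy)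
  refine hW.empty_notMem ((ZFSet.eq_empty _).2 (fun z hz => ?_) ▸ h4)
  simp only [ZFSet.mem_inter, ZFSet.mem_sdiff, mem_memSet hf hg, mem_memSet hg hf,
    mem_eqSet hf hg, mem_memSet hf hc', mem_memSet hg hc'] at hz
  obtain ⟨⟨⟨hz, h1⟩, ⟨-, h2⟩, ⟨-, h3⟩⟩, ⟨-, h5⟩, ⟨-, h6⟩⟩ := hz
  rw [app_const hz] at h5 h6
  have := htri _ h5 _ h6
  tauto

/-- The internal ultrapower of `Ult(V, U)` pulls the ultrafilter derived from a point back into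
`Ult(V, U)`. -/
theorem derived_mem_model {L : Ultrafilter ZFSet.{u}} {p : (ZFSet.{u} → ZFSet.{u}) → ZFSet.{u}}
    (C : Collapse L M p) {κ : ZFSet.{u}} (hL : NormalOn κ L) (hW : IsUltrafilterIn M W)
    (h : IsUltrapower M W N π) {x : ZFSet.{u}} (hx : x ∈ N) :
    (ZFSet.powerset κ).sep (fun A => x ∈ embedding W π A) ∈ M := by
  rw [← h.image_eq] at hx
  obtain ⟨f, hf, rfl⟩ := hx
  obtain ⟨w, rfl⟩ := C.exists_rep W hW.mem_model
  obtain ⟨φ, rfl⟩ := C.exists_rep f hf.1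
  -- By Łoś, the derived ultrafilter is computed pointwise from representatives `φ` of the function
  -- and `w` of `W`, with `κ` represented by the identity.
  have : (ZFSet.powerset κ).sep (fun A => π (p φ) ∈ embedding (p w) π A) =
      p fun y => (ZFSet.powerset y).sep fun A =>
        memSet (ZFSet.sUnion (w y)) (φ y) (const (w y) A) ∈ w y := by
    symm
    refine C.ext_subset (fun A hA => C.subset_mem_model hL
      (ZFSet.mem_powerset.1 (ZFSet.mem_sep.1 hA).1)) fun G => ?_
    simp only [ZFSet.mem_sep, ZFSet.mem_powerset, eventually_and]
    rw [← C.subset_iff_eventually_subset hL, ← C.mem_iff, C.map_memSet, C.map_sUnion, C.map_const,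
      embedding, h.mem_iff _ hf _ (const_mem_ultFun C.closedModel hW.mem_model (C.mem_model G))]
    rfl
  rw [this]
  exact C.mem_model _

end Internal

/-! ### The comparison argument. -/

theorem mem_model_of_embedding_mem {κ U₀ U₁ W₀ W₁ : ZFSet.{u}} (hκ : κ.IsOrdinal)
    (h₀ : IsNormalUltrafilter κ U₀) (h₁ : IsNormalUltrafilter κ U₁)
    {M₀ M₁ P : Set ZFSet.{u}} {p₀ p₁ : (ZFSet.{u} → ZFSet.{u}) → ZFSet.{u}}
    {ρ₀ ρ₁ : ZFSet.{u} → ZFSet.{u}}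
    (C₀ : Collapse (toUltrafilter h₀.toIsUltrafilterIn) M₀ p₀)
    (C₁ : Collapse (toUltrafilter h₁.toIsUltrafilterIn) M₁ p₁)
    (hW₀ : IsUltrafilterIn M₀ W₀) (hW₁ : IsUltrafilterIn M₁ W₁)
    (hρ₀ : IsUltrapower M₀ W₀ P ρ₀) (hρ₁ : IsUltrapower M₁ W₁ P ρ₁)
    (hcomm : ∀ a, embedding W₀ ρ₀ (p₀ fun _ => a) = embedding W₁ ρ₁ (p₁ fun _ => a))
    (hlt : embedding W₀ ρ₀ κ ∈ embedding W₁ ρ₁ κ) : U₀ ∈ M₁ := by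
  have hL₀ := h₀.normalOn hκ
  have hL₁ := h₁.normalOn hκ
  have hκ₀ : κ ∈ M₀ := C₀.subset_mem_model hL₀ fun _ h => h
  have hκ₁ : κ ∈ M₁ := C₁.subset_mem_model hL₁ fun _ h => h
  have hP : embedding W₀ ρ₀ κ ∈ P :=
    hρ₀.image_eq ▸ Set.mem_image_of_mem _ (const_mem_ultFun C₀.closedModel hW₀.mem_model hκ₀)
  have hU : U₀ = (ZFSet.powerset κ).sep fun A => embedding W₀ ρ₀ κ ∈ embedding W₁ ρ₁ A := by
    ext A
    rw [h₀.mem_iff, ZFSet.mem_sep, ZFSet.mem_powerset]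
    refine and_congr_right fun hA => ?_
    have hAκ : (p₁ fun _ => A) ∩ κ = A := by
      ext z
      rw [ZFSet.mem_inter]
      exact ⟨fun hz => (C₁.mem_map_const_iff hL₁ hz.2).1 hz.1,
        fun hz => ⟨(C₁.mem_map_const_iff hL₁ (hA hz)).2 hz, hA hz⟩⟩
    have hAM : (p₁ fun _ => A) ∩ κ ∈ M₁ := hAκ.symm ▸ C₁.subset_mem_model hL₁ hA
    rw [C₀.eventually_mem_iff hL₀,
      ← embedding_mem_embedding_iff C₀.closedModel hW₀ hρ₀ hκ₀ (C₀.mem_model _), hcomm,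
      ← mem_embedding_inter C₁.closedModel hW₁ hρ₁ (C₁.mem_model _) hκ₁ hAM hlt, hAκ]
  rw [hU]
  exact derived_mem_model C₁ hL₁ hW₁ hρ₁ hP

theorem mitchellLT_trichotomy (hUA : UltrapowerAxiom.{u}) {κ U₀ U₁ : ZFSet.{u}}
    (hκ : IsMeasurableCardinal κ) (h₀ : IsNormalUltrafilter κ U₀)
    (h₁ : IsNormalUltrafilter κ U₁) : MitchellLT U₀ U₁ ∨ U₀ = U₁ ∨ MitchellLT U₁ U₀ := by
  obtain ⟨W₀, W₁, M₀, M₁, P, π₀, π₁, ρ₀, ρ₁, hπ₀, hπ₁, hW₀, hW₁, hρ₀, hρ₁, hcomm⟩ :=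
    hUA U₀ U₁ (h₀.isCountablyCompleteIn hκ) (h₁.isCountablyCompleteIn hκ)
  replace hW₀ := hW₀.toIsUltrafilterIn
  replace hW₁ := hW₁.toIsUltrafilterIn
  obtain ⟨p₀, C₀, hp₀⟩ := hπ₀.exists_collapse h₀.toIsUltrafilterIn
  obtain ⟨p₁, C₁, hp₁⟩ := hπ₁.exists_collapse h₁.toIsUltrafilterIn
  simp only [hp₀, hp₁] at hcomm
  have hL₀ := h₀.normalOn hκ.ordinal
  have hL₁ := h₁.normalOn hκ.ordinal
  have hκ₀ : κ ∈ M₀ := C₀.subset_mem_model hL₀ fun _ h => h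
  have hκ₁ : κ ∈ M₁ := C₁.subset_mem_model hL₁ fun _ h => h
  -- Since `κ ∈ j₀(κ)` and `κ ∈ j₁(κ)`, both images of `κ` lie in the common ordinal, where
  -- `embedding_trichotomous` applies.
  have hx₀ : embedding W₀ ρ₀ κ ∈ embedding W₀ ρ₀ (p₀ fun _ => κ) :=
    (embedding_mem_embedding_iff C₀.closedModel hW₀ hρ₀ hκ₀ (C₀.mem_model _)).2
      ((C₀.eventually_mem_iff hL₀).1 hL₀.eventually_mem)
  have hx₁ : embedding W₁ ρ₁ κ ∈ embedding W₁ ρ₁ (p₁ fun _ => κ) :=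
    (embedding_mem_embedding_iff C₁.closedModel hW₁ hρ₁ hκ₁ (C₁.mem_model _)).2
      ((C₁.eventually_mem_iff hL₁).1 hL₁.eventually_mem)
  have hord : (p₀ fun _ => κ).IsOrdinal := C₀.isOrdinal (Eventually.of_forall fun _ => hκ.ordinal)
  rcases embedding_trichotomous C₀.closedModel hW₀ hρ₀ (C₀.mem_model _)
    (fun a ha b hb => (hord.mem ha).mem_trichotomous (hord.mem hb)) _ hx₀ _
    (hcomm κ ▸ hx₁) with hlt | heq | hlt
  · exact Or.inl ⟨M₁, π₁, hπ₁, mem_model_of_embedding_mem hκ.ordinal h₀ h₁ C₀ C₁ hW₀ hW₁ hρ₀ hρ₁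
      hcomm hlt⟩
  · refine Or.inr (Or.inl ?_)
    ext A
    rw [h₀.mem_iff, h₁.mem_iff, C₀.eventually_mem_iff hL₀, C₁.eventually_mem_iff hL₁,
      ← embedding_mem_embedding_iff C₀.closedModel hW₀ hρ₀ hκ₀ (C₀.mem_model _),
      ← embedding_mem_embedding_iff C₁.closedModel hW₁ hρ₁ hκ₁ (C₁.mem_model _), heq, hcomm]
  · exact Or.inr (Or.inr ⟨M₀, π₀, hπ₀, mem_model_of_embedding_mem hκ.ordinal h₁ h₀ C₁ C₀ hW₁ hW₀
      hρ₁ hρ₀ (fun a => (hcomm a).symm) hlt⟩)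

end SetUltrapower

theorem mainTheorem2 (hUA : SetUltrapower.UltrapowerAxiom.{u}) :
    (∀ κ U₀ U₁ : ZFSet.{u}, SetUltrapower.IsMeasurableCardinal κ →
      SetUltrapower.IsNormalUltrafilter κ U₀ → SetUltrapower.IsNormalUltrafilter κ U₁ →
        SetUltrapower.MitchellLT U₀ U₁ ∨ U₀ = U₁ ∨ SetUltrapower.MitchellLT U₁ U₀) ∧
    IsStrictTotalOrder
      {U : ZFSet.{u} // ∃ κ : ZFSet.{u}, SetUltrapower.IsMeasurableCardinal κ ∧
        SetUltrapower.IsNormalUltrafilter κ U}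
      (fun U W => SetUltrapower.MitchellLT U.1 W.1) := by
  refine ⟨fun κ U₀ U₁ hκ h₀ h₁ => SetUltrapower.mitchellLT_trichotomy hUA hκ h₀ h₁,
    { trichotomous := ?_, irrefl := ?_, trans := ?_ }⟩
  · rintro ⟨U₀, κ₀, hκ₀, h₀⟩ ⟨U₁, κ₁, hκ₁, h₁⟩ hlt hgt
    refine Subtype.ext ?_
    -- The axiom is needed only when the two cardinals coincide; otherwise the ultrafilter on the
    -- smaller cardinal is below.
    rcases hκ₀.ordinal.mem_trichotomous hκ₁.ordinal with h | rfl | h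
    · exact (hlt (SetUltrapower.mitchellLT_of_mem hκ₁ h₀ h₁ h)).elim
    · exact ((SetUltrapower.mitchellLT_trichotomy hUA hκ₀ h₀ h₁).resolve_left hlt).resolve_right hgt
    · exact (hgt (SetUltrapower.mitchellLT_of_mem hκ₀ h₁ h₀ h)).elim
  · rintro ⟨U, κ, hκ, h⟩
    exact SetUltrapower.not_mitchellLT_self hκ.ordinal h
  · rintro ⟨U₀, κ₀, hκ₀, h₀⟩ ⟨U₁, κ₁, hκ₁, h₁⟩ ⟨U₂, κ₂, hκ₂, h₂⟩ h h'
    exact SetUltrapower.mitchellLT_trans hκ₀ hκ₁ hκ₂ h₀ h₁ h₂ h h'
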